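/- Let $s=(s_n)_{n\ge0}$ be a real sequence with $s_0=1$, and let $V$ be the set of positive Borel measures on $\mathbb R$ that have moments of every order and satisfy $\int x^n\,d\mu(x)=s_n$ for all $n\ge 0$. Assume that $s$ is an indeterminate Stieltjes moment sequence (indet(S)), i.e. that more than one $\mu\in V$ is supported by $[0,\infty)$. Let $(P_n)$ be the orthonormal polynomials of $s$ (with $\deg P_n=n$ and positive leading coefficients). Put $a_n=\int xP_n^2\,d\mu$ and $b_n=\int xP_nP_{n+1}\,d\mu$ for $\mu\in V$. Let $(Q_n)$ be the polynomials of the second kind, given by $Q_0=0$, $Q_1=1/b_0$ and $xQ_n=b_nQ_{n+1}+a_nQ_n+b_{n-1}Q_{n-1}$ for $n\ge1$. Then $\sum_k|P_k(z)|^2<\infty$ and $\sum_k|Q_k(z)|^2<\infty$ for every $z\in\mathbb C$, so that $$A(z)=z\sum_{k\ge0}Q_k(z)Q_k(0),\qquad B(z)=-1+z\sum_{k\ge0}P_k(z)Q_k(0),$$ $$C(z)=1+z\sum_{k\ge0}Q_k(z)P_k(0),\qquad D(z)=z\sum_{k\ge0}P_k(z)P_k(0)$$ are well defined on $\mathbb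 C$, and the limits $$\alpha(s)=\lim_{n\to\infty}\frac{P_n(0)}{Q_n(0)}=\lim_{x\to-\infty}\frac{D(x)}{B(x)}\in\mathbb R$$ exist and agree. Let $x_{n,1}<\dots<x_{n,n}$ be the zeros of $P_n$. Then for every $k\ge1$ the limit $\xi_k=\lim_{n\to\infty}x_{n,k}$ exists, and $0<\xi_1<\xi_2<\cdots$ with $\xi_k\to\infty$. The function $B(z)\alpha(s)-D(z)$ is entire, and its set of zeros in $\mathbb C$ is exactly $\{\xi_k: k\ge1\}$. There is exactly one measure $\nu_{\alpha(s)}\in V$ (the Friedrichs solution) with $$\int\frac{d\nu_{\alpha(s)}(x)}{x-z}=-\frac{A(z)\alpha(s)-C(z)}{B(z)\alpha(s)-D(z)},\qquad z\in\mathbb C\setminus\mathbb R,$$ and its support is $\{\xi_k: k\ge1\}$. -/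

import Mathlib

open Polynomial Filter Topology MeasureTheory

noncomputable section

namespace StieltjesMoment

/-- `μ` solves the Hamburger moment problem for `s`: all moments of `μ` exist and are the `s n`. -/
def IsSolution (s : ℕ → ℝ) (μ : Measure ℝ) : Prop :=
  ∀ n : ℕ, Integrable (fun x : ℝ => x ^ n) μ ∧ ∫ x, x ^ n ∂μ = s n

/-- `indet(S)`: there is more than one solution supported by the half-line `[0, ∞)`. -/
def IndetS (s : ℕ → ℝ) : Prop :=
  ∃ μ₁ μ₂ : Measure ℝ, IsSolution s μ₁ ∧ IsSolution s μ₂ ∧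
    μ₁ (Set.Iio 0) = 0 ∧ μ₂ (Set.Iio 0) = 0 ∧ μ₁ ≠ μ₂

/-- The moment functional: the linear functional on `ℝ[X]` sending `X ^ n` to `s n`; it is
`p ↦ ∫ p dμ` for every solution `μ`. -/
def momentFun (s : ℕ → ℝ) (p : ℝ[X]) : ℝ :=
  p.sum fun n c => c * s n

/-- `q` divided by its norm with respect to the inner product `(p, q) ↦ momentFun s (p * q)`. -/
def normalizePoly (s : ℕ → ℝ) (q : ℝ[X]) : ℝ[X] :=
  C (√(momentFun s (q * q)))⁻¹ * q

/-- The orthonormal polynomials `P n`, obtained by the Gram-Schmidt process from `1, X, X ^ 2, …`;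
the leading coefficients are positive. -/
def P (s : ℕ → ℝ) (n : ℕ) : ℝ[X] :=
  normalizePoly s (X ^ n - ∑ k : Fin n, C (momentFun s (X ^ n * P s k)) * P s k)
termination_by n
decreasing_by exact k.2

/-- The diagonal Jacobi parameters `a n = ∫ x P_n(x)² dμ(x)`. -/
def jacobiA (s : ℕ → ℝ) (n : ℕ) : ℝ := momentFun s (X * P s n ^ 2)

/-- The off-diagonal Jacobi parameters `b n = ∫ x P_n(x) P_{n+1}(x) dμ(x)`. -/
def jacobiB (s : ℕ → ℝ) (n : ℕ) : ℝ := momentFun s (X * P s n * P s (n + 1))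

/-- The polynomials of the second kind: `Q 0 = 0`, `Q 1 = 1 / b 0` and
`x Q_n = b_n Q_{n+1} + a_n Q_n + b_{n-1} Q_{n-1}` for `n ≥ 1`. -/
def Q (s : ℕ → ℝ) : ℕ → ℝ[X]
  | 0 => 0
  | 1 => C (1 / jacobiB s 0)
  | n + 2 => C (1 / jacobiB s (n + 1)) *
      ((X - C (jacobiA s (n + 1))) * Q s (n + 1) - C (jacobiB s n) * Q s n)

/-- The Nevanlinna function `A(z) = A(z, 0)`. -/
def nevA (s : ℕ → ℝ) (z : ℂ) : ℂ := z * ∑' k : ℕ, aeval z (Q s k) * aeval (0 : ℂ) (Q s k)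

/-- The Nevanlinna function `B(z) = B(z, 0)`. -/
def nevB (s : ℕ → ℝ) (z : ℂ) : ℂ := -1 + z * ∑' k : ℕ, aeval z (P s k) * aeval (0 : ℂ) (Q s k)

/-- The Nevanlinna function `C(z) = C(z, 0)`. -/
def nevC (s : ℕ → ℝ) (z : ℂ) : ℂ := 1 + z * ∑' k : ℕ, aeval z (Q s k) * aeval (0 : ℂ) (P s k)

/-- The Nevanlinna function `D(z) = D(z, 0)`. -/
def nevD (s : ℕ → ℝ) (z : ℂ) : ℂ := z * ∑' k : ℕ, aeval z (P s k) * aeval (0 : ℂ) (P s k)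

/-- `α(s) = lim P_n(0) / Q_n(0)`. -/
def alpha (s : ℕ → ℝ) : ℝ :=
  limUnder atTop fun n : ℕ => (P s n).eval 0 / (Q s n).eval 0

/-- `x_{n,k+1}`: the zeros of `P n` in increasing order, the index `k` starting at `0`
(the value is a dummy `0` for `k ≥ n`). -/
def polyZero (s : ℕ → ℝ) (n k : ℕ) : ℝ :=
  ((P s n).roots.sort (· ≤ ·)).getD k 0

/-- `ξ_{k+1} = lim_n x_{n,k+1}`, the index `k` starting at `0`. -/
def xi (s : ℕ → ℝ) (k : ℕ) : ℝ :=
  limUnder atTop fun n : ℕ => polyZero s n k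

/-- `ν` is the N-extremal solution `ν_t`, `t ∈ ℝ`. -/
def IsNExtremal (s : ℕ → ℝ) (t : ℝ) (ν : Measure ℝ) : Prop :=
  IsSolution s ν ∧ ∀ z : ℂ, z.im ≠ 0 →
    ∫ x : ℝ, ((x : ℂ) - z)⁻¹ ∂ν = -((nevA s z * t - nevC s z) / (nevB s z * t - nevD s z))

/-- `ν` is the Friedrichs solution `ν_{α(s)}`. -/
def IsFriedrichs (s : ℕ → ℝ) (ν : Measure ℝ) : Prop :=
  IsNExtremal s (alpha s) ν

end StieltjesMoment

end

/-!
Let `w₁ ≠ w₂` be the values at a nonreal `z` of the Stieltjes transforms of two solutions. By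
Bessel's inequality the sequences `Q_n(z) + w_i P_n(z)` are square summable, hence so are `P_n(z)`
and `Q_n(z)`. Variation of constants for the three-term recurrence and a discrete Grönwall
inequality carry this over to all of `ℂ`, locally uniformly. By Christoffel-Darboux the entire
functions `A, B, C, D` are limits of Casorati determinants, and `A D - B C = 1`.

Positivity on the half-line makes the zeros of all `P_n` positive, so `P_n(0) / Q_n(0)` is negative
and increasing, with a limit `α ≤ 0`. If `α = 0`, an upper and a lower bound for the Stieltjes
transforms of the half-line solutions coincide on the negative axis, so there is only one such
solution; thus `α < 0`. On the negative axis `B / D` is asymptotically a weighted mean of the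
quotients `Q_k(0) / P_k(0)`, so that `D / B` also tends to `α`.

Interlacing makes `x_{n,k}` decrease in `n`, and `-P_n(z) / Q_n(0)` converges to `B(z) α - D(z)`
along convergent arguments, so this function vanishes at the limits `ξ_k`. Away from the zeros of
`P_n`, Gauss quadrature bounds `Q_n` by `P_n`; another zero of `B α - D` would therefore be a zero
of `A α - C`, against `A D - B C = 1`. The Gauss quadrature measures converge to the measure with
mass `1 / K(ξ_k, ξ_k)` at each `ξ_k`, where `K` is the reproducing kernel. As they have the correct
moments and live on the half-line, Chebyshev's inequality controls their tails, and moments and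
Stieltjes transforms pass to the limit. The limit is the only measure with its Stieltjes transform.
-/

noncomputable section

namespace StieltjesMoment

/-! ### Orthonormal polynomials -/

section OrthonormalPolynomials

/-- The moment functional `momentFun s`, as a linear map. -/
def momentLinearMap (s : ℕ → ℝ) : ℝ[X] →ₗ[ℝ] ℝ :=
  Polynomial.lsum fun n => s n • LinearMap.id

theorem momentLinearMap_apply (s : ℕ → ℝ) (p : ℝ[X]) : momentLinearMap s p = momentFun s p := by
  simp [momentFun, momentLinearMap, Polynomial.lsum_apply, mul_comm]

theorem momentFun_C_mul (s : ℕ → ℝ) (c : ℝ) (p : ℝ[X]) :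
    momentFun s (C c * p) = c * momentFun s p := by
  simp only [← momentLinearMap_apply, ← smul_eq_C_mul, map_smul, smul_eq_mul]

theorem momentFun_add (s : ℕ → ℝ) (p q : ℝ[X]) :
    momentFun s (p + q) = momentFun s p + momentFun s q := by
  simp only [← momentLinearMap_apply, map_add]

theorem momentFun_sub (s : ℕ → ℝ) (p q : ℝ[X]) :
    momentFun s (p - q) = momentFun s p - momentFun s q := by
  simp only [← momentLinearMap_apply, map_sub]

theorem momentFun_sum (s : ℕ → ℝ) {ι : Type*} (S : Finset ι) (f : ι → ℝ[X]) :
    momentFun s (∑ i ∈ S, f i) = ∑ i ∈ S, momentFun s (f i) := by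
  simp only [← momentLinearMap_apply, map_sum]

theorem momentFun_X_pow (s : ℕ → ℝ) (n : ℕ) : momentFun s (X ^ n) = s n := by
  simp [momentFun, X_pow_eq_monomial]

theorem momentFun_one (s : ℕ → ℝ) : momentFun s 1 = s 0 := by
  simpa using momentFun_X_pow s 0

/-- The moment functional of `s` is positive definite, i.e. `(p, q) ↦ momentFun s (p * q)` is an
inner product on `ℝ[X]`. -/
def PosDef (s : ℕ → ℝ) : Prop := ∀ p : ℝ[X], p ≠ 0 → 0 < momentFun s (p * p)

/-- The unnormalized output of the Gram-Schmidt process, so that `P s n` is its normalization. -/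
def monicP (s : ℕ → ℝ) (n : ℕ) : ℝ[X] :=
  X ^ n - ∑ k : Fin n, C (momentFun s (X ^ n * P s k)) * P s k

variable {s : ℕ → ℝ}

theorem P_eq_normalizePoly (s : ℕ → ℝ) (n : ℕ) : P s n = normalizePoly s (monicP s n) := by
  rw [P, monicP]

theorem degree_normalizePoly (hp : PosDef s) {q : ℝ[X]} (hq : q ≠ 0) :
    (normalizePoly s q).degree = q.degree :=
  degree_C_mul (inv_ne_zero (Real.sqrt_pos.2 (hp q hq)).ne')

theorem momentFun_normalizePoly_mul_self (hp : PosDef s) {q : ℝ[X]} (hq : q ≠ 0) :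
    momentFun s (normalizePoly s q * normalizePoly s q) = 1 := by
  have hpos := hp q hq
  rw [normalizePoly, mul_mul_mul_comm, ← C_mul, momentFun_C_mul, ← mul_inv,
    Real.mul_self_sqrt hpos.le, inv_mul_cancel₀ hpos.ne']

theorem degree_sum_C_mul_P_lt {n : ℕ} (h : ∀ k < n, (P s k).degree = k) :
    (∑ k : Fin n, C (momentFun s (X ^ n * P s k)) * P s k).degree < n := by
  refine (degree_sum_le _ _).trans_lt ((Finset.sup_lt_iff (WithBot.bot_lt_coe n)).2 fun k _ => ?_)
  rw [← smul_eq_C_mul]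
  exact (degree_smul_le _ _).trans_lt (h k k.2 ▸ Nat.cast_lt.2 k.2)

theorem degree_P (hp : PosDef s) (n : ℕ) : (P s n).degree = n := by
  induction n using Nat.strong_induction_on with
  | _ n ih =>
    have hlow := degree_sum_C_mul_P_lt ih
    have hne : monicP s n ≠ 0 := (monic_X_pow_sub hlow).ne_zero
    rw [P_eq_normalizePoly, degree_normalizePoly hp hne, monicP,
      degree_sub_eq_left_of_degree_lt (by rwa [degree_X_pow]), degree_X_pow]

theorem monic_monicP (hp : PosDef s) (n : ℕ) : (monicP s n).Monic :=
  monic_X_pow_sub (degree_sum_C_mul_P_lt fun k _ => degree_P hp k)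

theorem natDegree_P (hp : PosDef s) (n : ℕ) : (P s n).natDegree = n :=
  natDegree_eq_of_degree_eq_some (degree_P hp n)

theorem leadingCoeff_P_pos (hp : PosDef s) (n : ℕ) : 0 < (P s n).leadingCoeff := by
  rw [P_eq_normalizePoly, normalizePoly, leadingCoeff_mul, leadingCoeff_C,
    (monic_monicP hp n).leadingCoeff, mul_one]
  exact inv_pos.2 (Real.sqrt_pos.2 (hp _ (monic_monicP hp n).ne_zero))

theorem P_ne_zero (hp : PosDef s) (n : ℕ) : P s n ≠ 0 :=
  leadingCoeff_ne_zero.1 (leadingCoeff_P_pos hp n).ne'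

theorem P_zero (hs0 : s 0 = 1) : P s 0 = 1 := by
  rw [P_eq_normalizePoly, monicP, normalizePoly]
  simp [momentFun_one, hs0]

theorem momentFun_P_mul_self (hp : PosDef s) (n : ℕ) : momentFun s (P s n * P s n) = 1 := by
  rw [P_eq_normalizePoly]
  exact momentFun_normalizePoly_mul_self hp (monic_monicP hp n).ne_zero

theorem momentFun_P_mul_P_of_lt (hp : PosDef s) {j n : ℕ} (hj : j < n) :
    momentFun s (P s n * P s j) = 0 := by
  induction n using Nat.strong_induction_on generalizing j with
  | _ n ih =>
    have hother : ∀ k : Fin n, k ≠ ⟨j, hj⟩ →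
        momentFun s (C (momentFun s (X ^ n * P s k)) * P s k * P s j) = 0 := by
      intro k hk
      have hkj : momentFun s (P s k * P s j) = 0 := by
        rcases lt_or_gt_of_ne (fun h => hk (Fin.ext h) : (k : ℕ) ≠ j) with h | h
        · rw [mul_comm, ih j hj h]
        · exact ih k k.2 h
      rw [mul_assoc, momentFun_C_mul, hkj, mul_zero]
    rw [P_eq_normalizePoly s n, normalizePoly, mul_assoc, momentFun_C_mul]
    refine mul_eq_zero_of_right _ ?_
    rw [monicP, sub_mul, momentFun_sub, Finset.sum_mul, momentFun_sum,
      Finset.sum_eq_single_of_mem _ (Finset.mem_univ _) fun k _ hk => hother k hk,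
      mul_assoc, momentFun_C_mul, momentFun_P_mul_self hp, mul_one, sub_self]

theorem momentFun_P_mul_P (hp : PosDef s) (m n : ℕ) :
    momentFun s (P s m * P s n) = if m = n then 1 else 0 := by
  rcases lt_trichotomy m n with h | h | h
  · rw [mul_comm, momentFun_P_mul_P_of_lt hp h, if_neg h.ne]
  · rw [h, momentFun_P_mul_self hp, if_pos rfl]
  · rw [momentFun_P_mul_P_of_lt hp h, if_neg h.ne']

theorem mem_span_P (hp : PosDef s) {n : ℕ} {q : ℝ[X]} (hq : q.degree < n) :
    q ∈ Submodule.span ℝ (P s '' Finset.range n) := by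
  let S : Polynomial.Sequence ℝ := ⟨P s, degree_P hp⟩
  have hspan : Submodule.span ℝ (P s '' Set.Iio n) = degreeLT ℝ n :=
    S.span_degreeLT fun i _ => (leadingCoeff_P_pos hp i).ne'.isUnit
  rw [Finset.coe_range, hspan]
  exact mem_degreeLT.2 hq

theorem eq_sum_momentFun_mul_P (hp : PosDef s) {n : ℕ} {q : ℝ[X]} (hq : q.degree < n) :
    q = ∑ k ∈ Finset.range n, C (momentFun s (q * P s k)) * P s k := by
  obtain ⟨c, rfl⟩ := (Submodule.mem_span_image_finset_iff_exists_fun ℝ).1 (mem_span_P hp hq)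
  rw [← Finset.sum_coe_sort (Finset.range n)]
  refine Finset.sum_congr rfl fun j _ => ?_
  rw [Finset.sum_mul, momentFun_sum, Finset.sum_eq_single_of_mem j (Finset.mem_univ j)]
  · rw [smul_eq_C_mul, mul_assoc, momentFun_C_mul, momentFun_P_mul_self hp, mul_one]
  · intro k _ hk
    rw [smul_eq_C_mul, mul_assoc, momentFun_C_mul, momentFun_P_mul_P hp,
      if_neg (Subtype.coe_ne_coe.2 hk), mul_zero]

theorem momentFun_mul_P_eq_zero (hp : PosDef s) {n : ℕ} {q : ℝ[X]} (hq : q.degree < n) :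
    momentFun s (q * P s n) = 0 := by
  rw [eq_sum_momentFun_mul_P hp hq, Finset.sum_mul, momentFun_sum]
  refine Finset.sum_eq_zero fun k hk => ?_
  rw [mul_assoc, momentFun_C_mul, momentFun_P_mul_P hp, if_neg (Finset.mem_range.1 hk).ne, mul_zero]

theorem momentFun_P_succ (hp : PosDef s) (n : ℕ) : momentFun s (P s (n + 1)) = 0 := by
  simpa using momentFun_mul_P_eq_zero (q := 1) hp
    (degree_one_le.trans_lt (by exact_mod_cast n.succ_pos : (0 : WithBot ℕ) < (n + 1 : ℕ)))

theorem degree_X_mul_P (hp : PosDef s) (n : ℕ) :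
    (X * P s n).degree = ((n + 1 : ℕ) : WithBot ℕ) := by
  rw [degree_mul, degree_X, degree_P hp, add_comm, Nat.cast_succ]

theorem degree_X_mul_P_lt (hp : PosDef s) (n : ℕ) :
    (X * P s n).degree < ((n + 2 : ℕ) : WithBot ℕ) := by
  rw [degree_X_mul_P hp]
  exact_mod_cast (n + 1).lt_succ_self

theorem X_mul_P_zero (hp : PosDef s) :
    X * P s 0 = C (jacobiB s 0) * P s 1 + C (jacobiA s 0) * P s 0 := by
  conv_lhs => rw [eq_sum_momentFun_mul_P hp (degree_X_mul_P_lt hp 0)]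
  rw [Finset.sum_range_succ, Finset.sum_range_one, jacobiA, jacobiB, sq,
    mul_assoc X (P s 0) (P s 0), add_comm]

theorem X_mul_P_succ (hp : PosDef s) (n : ℕ) :
    X * P s (n + 1) = C (jacobiB s (n + 1)) * P s (n + 2) + C (jacobiA s (n + 1)) * P s (n + 1) +
      C (jacobiB s n) * P s n := by
  have hlow : ∀ k ∈ Finset.range n,
      C (momentFun s (X * P s (n + 1) * P s k)) * P s k = 0 := by
    intro k hk
    rw [mul_right_comm, momentFun_mul_P_eq_zero hp, C_0, zero_mul]
    rw [degree_X_mul_P hp]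
    exact_mod_cast Nat.succ_lt_succ (Finset.mem_range.1 hk)
  conv_lhs => rw [eq_sum_momentFun_mul_P hp (degree_X_mul_P_lt hp (n + 1))]
  rw [Finset.sum_range_succ, Finset.sum_range_succ, Finset.sum_range_succ,
    Finset.sum_eq_zero hlow, jacobiA, jacobiB, jacobiB, sq, mul_assoc X (P s (n + 1)) (P s (n + 1)),
    mul_right_comm X (P s n)]
  ring

theorem leadingCoeff_P_eq_jacobiB_mul (hp : PosDef s) (n : ℕ) :
    (P s n).leadingCoeff = jacobiB s n * (P s (n + 1)).leadingCoeff := by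
  have hlead : ∀ k, (P s k).leadingCoeff = (P s k).coeff k := fun k => by
    rw [leadingCoeff, natDegree_P hp]
  have hzero : ∀ k ≤ n, (P s k).coeff (n + 1) = 0 := fun k hk =>
    coeff_eq_zero_of_natDegree_lt (by rw [natDegree_P hp]; omega)
  rw [hlead, hlead, ← coeff_X_mul]
  cases n with
  | zero => simp [X_mul_P_zero hp, hzero 0 le_rfl]
  | succ n => simp [X_mul_P_succ hp, hzero (n + 1) le_rfl, hzero n n.le_succ]

theorem jacobiB_pos (hp : PosDef s) (n : ℕ) : 0 < jacobiB s n :=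
  pos_of_mul_pos_left (leadingCoeff_P_eq_jacobiB_mul hp n ▸ leadingCoeff_P_pos hp n)
    (leadingCoeff_P_pos hp (n + 1)).le

end OrthonormalPolynomials

/-! ### Jacobi recurrences and Casorati determinants -/

section Casorati

variable {R : Type*} [CommRing R]

/-- `f` solves the three-term recurrence with Jacobi parameters `a`, `b` and spectral parameter `z`
from the index `1` on; nothing is required at the index `0`, so that the polynomials of the first
and of the second kind are both solutions. -/
def IsJacobiRec (a b : ℕ → R) (z : R) (f : ℕ → R) : Prop :=
  ∀ n, z * f (n + 1) = b (n + 1) * f (n + 2) + a (n + 1) * f (n + 1) + b n * f n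

/-- The Casorati determinant of two sequences, the discrete analogue of the Wronskian, for the
off-diagonal Jacobi parameters `b`. -/
def casorati (b f g : ℕ → R) (n : ℕ) : R := b n * (f (n + 1) * g n - f n * g (n + 1))

theorem IsJacobiRec.sub_mul_sum {a b f g : ℕ → R} {z w : R} (hf : IsJacobiRec a b z f)
    (hg : IsJacobiRec a b w g) (n : ℕ) :
    (z - w) * ∑ k ∈ Finset.range (n + 1), f k * g k =
      casorati b f g n - casorati b f g 0 + (z - w) * (f 0 * g 0) := by
  induction n with
  | zero => simp
  | succ n ih =>
    rw [Finset.sum_range_succ, mul_add, ih]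
    simp only [casorati]
    linear_combination g (n + 1) * hf n - f (n + 1) * hg n

theorem casorati_mul_succ (b f p q : ℕ → R) (n : ℕ) :
    casorati b q p n * f (n + 1) =
      casorati b f p n * q (n + 1) - casorati b f q n * p (n + 1) := by
  simp only [casorati]
  ring

theorem casorati_plucker (b p q p' q' : ℕ → R) (n : ℕ) :
    casorati b q q' n * casorati b p p' n - casorati b p q' n * casorati b q p' n =
      casorati b q p n * casorati b q' p' n := by
  simp only [casorati]
  ring

end Casorati

section Growth

theorem le_mul_exp_of_le_mul_one_add_sum {v g : ℕ → ℝ} {r : ℝ} (hv : ∀ n, 0 ≤ v n) (hr : 0 ≤ r)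
    (h : ∀ n, g n ≤ v n * (1 + r * ∑ k ∈ Finset.range n, v k * g k)) (n : ℕ) :
    g n ≤ v n * Real.exp (r * ∑ k ∈ Finset.range n, v k ^ 2) := by
  set u : ℕ → ℝ := fun n => 1 + r * ∑ k ∈ Finset.range n, v k * g k with hu
  have hstep : ∀ k ≥ 0, u (k + 1) ≤ (1 + r * v k ^ 2) * u k + 0 := by
    intro k _
    have hk := mul_le_mul_of_nonneg_left (h k) (mul_nonneg hr (hv k))
    simp only [hu, Finset.sum_range_succ] at hk ⊢
    linarith
  have hgronwall : u n ≤ Real.exp (r * ∑ k ∈ Finset.range n, v k ^ 2) := by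
    simpa [hu, Finset.mul_sum] using discrete_gronwall (n₀ := 0) (by simp [hu]) hstep
      (fun k _ => mul_nonneg hr (sq_nonneg (v k))) (fun _ _ => le_rfl) n.zero_le
  exact (h n).trans (mul_le_mul_of_nonneg_left hgronwall (hv n))

variable {𝕜 : Type*} [NormedField 𝕜]

theorem norm_mul_sub_mul_le (p q p' q' : 𝕜) :
    ‖p * q' - q * p'‖ ≤ (‖p'‖ + ‖q'‖) * (‖p‖ + ‖q‖) := by
  have h := norm_sub_le (p * q') (q * p')
  rw [norm_mul, norm_mul] at h
  nlinarith [norm_nonneg p, norm_nonneg q, norm_nonneg p', norm_nonneg q',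
    mul_nonneg (norm_nonneg p) (norm_nonneg p'), mul_nonneg (norm_nonneg q) (norm_nonneg q')]

/-- Variation of constants turns the hypotheses into a Volterra equation for `f`, to which the
discrete Grönwall inequality applies. -/
theorem norm_le_of_casorati_eq {b f p q : ℕ → 𝕜} {c d ζ : 𝕜} (hqp : ∀ n, casorati b q p n = 1)
    (hc : ‖c‖ ≤ 1) (hd : ‖d‖ ≤ 1) (h0 : ‖f 0‖ ≤ ‖p 0‖ + ‖q 0‖)
    (hfp : ∀ n, casorati b f p n = c + ζ * ∑ k ∈ Finset.range (n + 1), f k * p k)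
    (hfq : ∀ n, casorati b f q n = d + ζ * ∑ k ∈ Finset.range (n + 1), f k * q k) (n : ℕ) :
    ‖f n‖ ≤ (‖p n‖ + ‖q n‖) *
      Real.exp (‖ζ‖ * ∑ k ∈ Finset.range n, (‖p k‖ + ‖q k‖) ^ 2) := by
  refine le_mul_exp_of_le_mul_one_add_sum (v := fun n => ‖p n‖ + ‖q n‖) (g := fun n => ‖f n‖)
    (fun _ => by positivity) (norm_nonneg _) (fun n => ?_) n
  cases n with
  | zero => simpa using h0
  | succ n =>
    have hvolterra : f (n + 1) = (c * q (n + 1) - d * p (n + 1)) +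
        ζ * ∑ k ∈ Finset.range (n + 1), f k * (p k * q (n + 1) - q k * p (n + 1)) := by
      have hvar := casorati_mul_succ b f p q n
      rw [hqp, one_mul, hfp, hfq] at hvar
      simp only [hvar, mul_sub, ← mul_assoc, Finset.sum_sub_distrib, ← Finset.sum_mul]
      ring
    calc ‖f (n + 1)‖
        ≤ ‖c * q (n + 1) - d * p (n + 1)‖ +
          ‖ζ‖ * ∑ k ∈ Finset.range (n + 1), ‖f k * (p k * q (n + 1) - q k * p (n + 1))‖ := by
          rw [hvolterra]
          refine (norm_add_le _ _).trans ?_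
          rw [norm_mul ζ]
          gcongr
          exact norm_sum_le _ _
      _ ≤ (‖p (n + 1)‖ + ‖q (n + 1)‖) + ‖ζ‖ * ∑ k ∈ Finset.range (n + 1),
          (‖p (n + 1)‖ + ‖q (n + 1)‖) * ((‖p k‖ + ‖q k‖) * ‖f k‖) := by
          gcongr with k
          · refine (norm_sub_le _ _).trans ?_
            rw [norm_mul, norm_mul, add_comm]
            exact add_le_add (mul_le_of_le_one_left (norm_nonneg _) hd)
              (mul_le_of_le_one_left (norm_nonneg _) hc)
          · rw [norm_mul, mul_comm, ← mul_assoc]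
            gcongr
            exact norm_mul_sub_mul_le _ _ _ _
      _ = _ := by rw [← Finset.mul_sum]; ring

end Growth

/-! ### The Christoffel-Darboux formulas -/

section ChristoffelDarboux

variable {s : ℕ → ℝ}

theorem isJacobiRec_P (hp : PosDef s) :
    IsJacobiRec (fun n => C (jacobiA s n)) (fun n => C (jacobiB s n)) X (P s) :=
  X_mul_P_succ hp

theorem isJacobiRec_Q (hp : PosDef s) :
    IsJacobiRec (fun n => C (jacobiA s n)) (fun n => C (jacobiB s n)) X (Q s) := by
  intro n
  rw [Q, ← mul_assoc, ← C_mul, mul_one_div_cancel (jacobiB_pos hp (n + 1)).ne', C_1]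
  ring

theorem C_jacobiB_mul_P_one (hp : PosDef s) (hs0 : s 0 = 1) :
    C (jacobiB s 0) * P s 1 = X - C (jacobiA s 0) := by
  linear_combination (norm := (rw [P_zero hs0]; ring)) -X_mul_P_zero hp

theorem C_jacobiB_mul_Q_one (hp : PosDef s) : C (jacobiB s 0) * Q s 1 = 1 := by
  rw [Q, ← C_mul, mul_one_div_cancel (jacobiB_pos hp 0).ne', C_1]

variable {K : Type*} [CommRing K] [Algebra ℝ K]

theorem IsJacobiRec.aeval {F : ℕ → ℝ[X]}
    (hF : IsJacobiRec (fun n => C (jacobiA s n)) (fun n => C (jacobiB s n)) X F) (z : K) :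
    IsJacobiRec (fun n => algebraMap ℝ K (jacobiA s n)) (fun n => algebraMap ℝ K (jacobiB s n)) z
      (fun n => aeval z (F n)) := by
  intro n
  simpa using congrArg (Polynomial.aeval z) (hF n)

/-- The Casorati determinant of the values at `z` of `F` and the values at `w` of `G`. For `F`, `G`
among `P`, `Q` and `w = 0` these are the partial sums of the Nevanlinna functions. -/
def polyCasorati (s : ℕ → ℝ) (F G : ℕ → ℝ[X]) (n : ℕ) (z w : K) : K :=
  casorati (fun k => algebraMap ℝ K (jacobiB s k)) (fun k => aeval z (F k))
    (fun k => aeval w (G k)) n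

theorem polyCasorati_eq {F G : ℕ → ℝ[X]}
    (hF : IsJacobiRec (fun n => C (jacobiA s n)) (fun n => C (jacobiB s n)) X F)
    (hG : IsJacobiRec (fun n => C (jacobiA s n)) (fun n => C (jacobiB s n)) X G)
    (z w : K) (n : ℕ) :
    polyCasorati s F G n z w = polyCasorati s F G 0 z w - (z - w) * (aeval z (F 0) * aeval w (G 0))
      + (z - w) * ∑ k ∈ Finset.range (n + 1), aeval z (F k) * aeval w (G k) := by
  rw [(hF.aeval z).sub_mul_sum (hG.aeval w)]
  simp only [polyCasorati]
  ring

theorem aeval_P_zero (hs0 : s 0 = 1) (z : K) : aeval z (P s 0) = 1 := by rw [P_zero hs0, map_one]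

theorem aeval_Q_zero (z : K) : aeval z (Q s 0) = 0 := by rw [Q, map_zero]

theorem algebraMap_jacobiB_mul_aeval_P_one (hp : PosDef s) (hs0 : s 0 = 1) (z : K) :
    algebraMap ℝ K (jacobiB s 0) * aeval z (P s 1) = z - algebraMap ℝ K (jacobiA s 0) := by
  simpa using congrArg (aeval z) (C_jacobiB_mul_P_one hp hs0)

theorem algebraMap_jacobiB_mul_aeval_Q_one (hp : PosDef s) (z : K) :
    algebraMap ℝ K (jacobiB s 0) * aeval z (Q s 1) = 1 := by
  simpa using congrArg (aeval z) (C_jacobiB_mul_Q_one hp)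

theorem polyCasorati_P_P (hp : PosDef s) (hs0 : s 0 = 1) (z w : K) (n : ℕ) :
    polyCasorati s (P s) (P s) n z w =
      (z - w) * ∑ k ∈ Finset.range (n + 1), aeval z (P s k) * aeval w (P s k) := by
  rw [polyCasorati_eq (isJacobiRec_P hp) (isJacobiRec_P hp)]
  simp only [polyCasorati, casorati, aeval_P_zero hs0, zero_add]
  linear_combination algebraMap_jacobiB_mul_aeval_P_one hp hs0 z -
    algebraMap_jacobiB_mul_aeval_P_one hp hs0 w

theorem polyCasorati_P_Q (hp : PosDef s) (hs0 : s 0 = 1) (z w : K) (n : ℕ) :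
    polyCasorati s (P s) (Q s) n z w =
      -1 + (z - w) * ∑ k ∈ Finset.range (n + 1), aeval z (P s k) * aeval w (Q s k) := by
  rw [polyCasorati_eq (isJacobiRec_P hp) (isJacobiRec_Q hp)]
  simp only [polyCasorati, casorati, aeval_P_zero hs0, aeval_Q_zero, zero_add]
  linear_combination -algebraMap_jacobiB_mul_aeval_Q_one hp w

theorem polyCasorati_Q_P (hp : PosDef s) (hs0 : s 0 = 1) (z w : K) (n : ℕ) :
    polyCasorati s (Q s) (P s) n z w =
      1 + (z - w) * ∑ k ∈ Finset.range (n + 1), aeval z (Q s k) * aeval w (P s k) := by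
  rw [polyCasorati_eq (isJacobiRec_Q hp) (isJacobiRec_P hp)]
  simp only [polyCasorati, casorati, aeval_P_zero hs0, aeval_Q_zero, zero_add]
  linear_combination algebraMap_jacobiB_mul_aeval_Q_one hp z

theorem polyCasorati_Q_Q (hp : PosDef s) (z w : K) (n : ℕ) :
    polyCasorati s (Q s) (Q s) n z w =
      (z - w) * ∑ k ∈ Finset.range (n + 1), aeval z (Q s k) * aeval w (Q s k) := by
  rw [polyCasorati_eq (isJacobiRec_Q hp) (isJacobiRec_Q hp)]
  simp only [polyCasorati, casorati, aeval_Q_zero]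
  ring

theorem polyCasorati_Q_P_self (hp : PosDef s) (hs0 : s 0 = 1) (z : K) (n : ℕ) :
    polyCasorati s (Q s) (P s) n z z = 1 := by
  rw [polyCasorati_Q_P hp hs0, sub_self, zero_mul, add_zero]

theorem aeval_succ_eq_polyCasorati (hp : PosDef s) (hs0 : s 0 = 1) (F : ℕ → ℝ[X]) (z w : K)
    (n : ℕ) :
    aeval z (F (n + 1)) = polyCasorati s F (P s) n z w * aeval w (Q s (n + 1)) -
      polyCasorati s F (Q s) n z w * aeval w (P s (n + 1)) := by
  have h := casorati_mul_succ (fun k => algebraMap ℝ K (jacobiB s k)) (fun k => aeval z (F k))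
    (fun k => aeval w (P s k)) (fun k => aeval w (Q s k)) n
  have hself := polyCasorati_Q_P_self hp hs0 w n
  simp only [polyCasorati] at hself ⊢
  rwa [hself, one_mul] at h

theorem polyCasorati_det (hp : PosDef s) (hs0 : s 0 = 1) (z w : K) (n : ℕ) :
    polyCasorati s (Q s) (Q s) n z w * polyCasorati s (P s) (P s) n z w -
      polyCasorati s (P s) (Q s) n z w * polyCasorati s (Q s) (P s) n z w = 1 := by
  have h := casorati_plucker (fun k => algebraMap ℝ K (jacobiB s k)) (fun k => aeval z (P s k))
    (fun k => aeval z (Q s k)) (fun k => aeval w (P s k)) (fun k => aeval w (Q s k)) n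
  have hz := polyCasorati_Q_P_self hp hs0 z n
  have hw := polyCasorati_Q_P_self hp hs0 w n
  simp only [polyCasorati] at hz hw ⊢
  rw [h, hz, hw, one_mul]

end ChristoffelDarboux

/-! ### Locally uniform square summability and the Nevanlinna functions -/

section Nevanlinna

/-- The values `F n z` are square summable in `n`, uniformly for `z` in any given disc. For the
orthonormal polynomials of both kinds this is the indeterminate case of the moment problem. -/
def LocallySquareSummable (F : ℕ → ℝ[X]) : Prop :=
  ∀ R : ℝ, ∃ u : ℕ → ℝ, (Summable fun n => u n ^ 2) ∧
    ∀ z : ℂ, ‖z‖ ≤ R → ∀ n, ‖aeval z (F n)‖ ≤ u n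

theorem locallySquareSummable_of_norm_le_mul_exp {F : ℕ → ℝ[X]} {w : ℂ} {v : ℕ → ℝ}
    (hv : ∀ n, 0 ≤ v n) (hv2 : Summable fun n => v n ^ 2)
    (h : ∀ z n, ‖aeval z (F n)‖ ≤ v n * Real.exp (‖z - w‖ * ∑ k ∈ Finset.range n, v k ^ 2)) :
    LocallySquareSummable F := by
  refine fun R => ⟨fun n => v n * Real.exp ((R + ‖w‖) * ∑' k, v k ^ 2), ?_, fun z hz n => ?_⟩
  · simp only [mul_pow]
    exact hv2.mul_right _
  · refine (h z n).trans (mul_le_mul_of_nonneg_left (Real.exp_le_exp.2 ?_) (hv n))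
    have hzw : ‖z - w‖ ≤ R + ‖w‖ := (norm_sub_le z w).trans (add_le_add_left hz _)
    exact mul_le_mul hzw (hv2.sum_le_tsum _ fun _ _ => sq_nonneg _)
      (Finset.sum_nonneg fun _ _ => sq_nonneg _) ((norm_nonneg _).trans hzw)

namespace LocallySquareSummable

variable {F G : ℕ → ℝ[X]}

theorem summable_norm_sq (hF : LocallySquareSummable F) (z : ℂ) :
    Summable fun n => ‖aeval z (F n)‖ ^ 2 := by
  obtain ⟨u, hu, hFu⟩ := hF ‖z‖
  exact hu.of_nonneg_of_le (fun n => by positivity)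
    fun n => pow_le_pow_left₀ (norm_nonneg _) (hFu z le_rfl n) 2

theorem exists_summable_norm_mul_le (hF : LocallySquareSummable F) (hG : LocallySquareSummable G)
    (R : ℝ) : ∃ u : ℕ → ℝ, Summable u ∧ ∀ z w : ℂ, ‖z‖ ≤ R → ‖w‖ ≤ R → ∀ n,
      ‖aeval z (F n) * aeval w (G n)‖ ≤ u n := by
  obtain ⟨u, hu, hFu⟩ := hF R
  obtain ⟨v, hv, hGv⟩ := hG R
  refine ⟨fun n => u n ^ 2 + v n ^ 2, hu.add hv, fun z w hz hw n => ?_⟩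
  rw [norm_mul]
  have hFn := pow_le_pow_left₀ (norm_nonneg _) (hFu z hz n) 2
  have hGn := pow_le_pow_left₀ (norm_nonneg _) (hGv w hw n) 2
  nlinarith [sq_nonneg (‖aeval z (F n)‖ - ‖aeval w (G n)‖), sq_nonneg (u n), sq_nonneg (v n)]

theorem summable_mul (hF : LocallySquareSummable F) (hG : LocallySquareSummable G) (z w : ℂ) :
    Summable fun n => aeval z (F n) * aeval w (G n) := by
  obtain ⟨u, hu, hFG⟩ := hF.exists_summable_norm_mul_le hG (max ‖z‖ ‖w‖)
  exact .of_norm_bounded hu (hFG z w (le_max_left _ _) (le_max_right _ _))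

theorem exists_summable_eventually_norm_mul_le (hF : LocallySquareSummable F)
    (hG : LocallySquareSummable G) {ι : Type*} {l : Filter ι} {z w : ι → ℂ} {a b : ℂ}
    (hz : Tendsto z l (𝓝 a)) (hw : Tendsto w l (𝓝 b)) :
    ∃ u : ℕ → ℝ, Summable u ∧ ∀ᶠ i in l, ∀ n, ‖aeval (z i) (F n) * aeval (w i) (G n)‖ ≤ u n := by
  obtain ⟨u, hu, hFG⟩ := hF.exists_summable_norm_mul_le hG (max (‖a‖ + 1) (‖b‖ + 1))
  refine ⟨u, hu, ?_⟩
  filter_upwards [hz.norm.eventually (eventually_le_nhds (lt_add_one ‖a‖)),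
    hw.norm.eventually (eventually_le_nhds (lt_add_one ‖b‖))] with i hzi hwi
  exact hFG _ _ (hzi.trans (le_max_left _ _)) (hwi.trans (le_max_right _ _))

theorem tendsto_tsum (hF : LocallySquareSummable F) (hG : LocallySquareSummable G)
    {ι : Type*} {l : Filter ι} {z w : ι → ℂ} {a b : ℂ}
    (hz : Tendsto z l (𝓝 a)) (hw : Tendsto w l (𝓝 b)) :
    Tendsto (fun i => ∑' k, aeval (z i) (F k) * aeval (w i) (G k)) l
      (𝓝 (∑' k, aeval a (F k) * aeval b (G k))) := by
  obtain ⟨u, hu, hFG⟩ := hF.exists_summable_eventually_norm_mul_le hG hz hw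
  exact tendsto_tsum_of_dominated_convergence hu (fun k =>
    (((F k).continuous_aeval.tendsto a).comp hz).mul (((G k).continuous_aeval.tendsto b).comp hw))
    hFG

theorem tendsto_sum_range (hF : LocallySquareSummable F) (hG : LocallySquareSummable G)
    {ι : Type*} {l : Filter ι} {z w : ι → ℂ} {a b : ℂ} {N : ι → ℕ}
    (hz : Tendsto z l (𝓝 a)) (hw : Tendsto w l (𝓝 b)) (hN : Tendsto N l atTop) :
    Tendsto (fun i => ∑ k ∈ Finset.range (N i), aeval (z i) (F k) * aeval (w i) (G k)) l
      (𝓝 (∑' k, aeval a (F k) * aeval b (G k))) := by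
  obtain ⟨u, hu, hFG⟩ := hF.exists_summable_eventually_norm_mul_le hG hz hw
  refine Tendsto.congr (fun i => (sum_eq_tsum_indicator _ (Finset.range (N i))).symm)
    (tendsto_tsum_of_dominated_convergence hu (fun k => ?_) ?_)
  · refine Tendsto.congr' ?_ ((((F k).continuous_aeval.tendsto a).comp hz).mul
      (((G k).continuous_aeval.tendsto b).comp hw))
    filter_upwards [hN.eventually_gt_atTop k] with i hi
    rw [Set.indicator_of_mem (Finset.mem_coe.2 (Finset.mem_range.2 hi))]
    rfl
  · filter_upwards [hFG] with i hi k
    exact (norm_indicator_le_norm_self _ _).trans (hi k)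

theorem differentiable_tsum (hF : LocallySquareSummable F) (hG : LocallySquareSummable G) (b : ℂ) :
    Differentiable ℂ fun z => ∑' k, aeval z (F k) * aeval b (G k) := by
  intro z
  obtain ⟨u, hu, hFG⟩ := hF.exists_summable_norm_mul_le hG (max (‖z‖ + 1) ‖b‖)
  have hdiff := Complex.differentiableOn_tsum_of_summable_norm (U := Metric.ball 0 (‖z‖ + 1))
    (F := fun k z => aeval z (F k) * aeval b (G k)) hu
    (fun k => ((F k).differentiable_aeval.mul_const _).differentiableOn) Metric.isOpen_ball
    fun k w hw => hFG w b ((mem_ball_zero_iff.1 hw).le.trans (le_max_left _ _))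
      (le_max_right _ _) k
  exact hdiff.differentiableAt (Metric.isOpen_ball.mem_nhds (by simp))

end LocallySquareSummable

variable {s : ℕ → ℝ}

theorem locallySquareSummable_P_and_Q (hp : PosDef s) (hs0 : s 0 = 1) {w : ℂ}
    (hP : Summable fun n => ‖aeval w (P s n)‖ ^ 2)
    (hQ : Summable fun n => ‖aeval w (Q s n)‖ ^ 2) :
    LocallySquareSummable (P s) ∧ LocallySquareSummable (Q s) := by
  have hv2 : Summable fun n => (‖aeval w (P s n)‖ + ‖aeval w (Q s n)‖) ^ 2 :=
    ((hP.add hQ).mul_left 2).of_nonneg_of_le (fun n => sq_nonneg _) fun n => add_sq_le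
  have hqp := polyCasorati_Q_P_self hp hs0 w
  constructor
  · refine locallySquareSummable_of_norm_le_mul_exp (fun n => by positivity) hv2 fun z n =>
      norm_le_of_casorati_eq (f := fun k => aeval z (P s k)) hqp (c := 0) (d := -1) (by simp)
        (by simp) (by simp [aeval_P_zero hs0])
        (fun n => ?_) (polyCasorati_P_Q hp hs0 z w) n
    rw [zero_add]
    exact polyCasorati_P_P hp hs0 z w n
  · refine locallySquareSummable_of_norm_le_mul_exp (fun n => by positivity) hv2 fun z n =>
      norm_le_of_casorati_eq (f := fun k => aeval z (Q s k)) hqp (c := 1) (d := 0) (by simp)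
        (by simp) (by simp [aeval_Q_zero])
        (polyCasorati_Q_P hp hs0 z w) (fun n => ?_) n
    rw [zero_add]
    exact polyCasorati_Q_Q hp z w n

theorem differentiable_nevB (hP : LocallySquareSummable (P s)) (hQ : LocallySquareSummable (Q s)) :
    Differentiable ℂ (nevB s) :=
  (differentiable_id.mul (hP.differentiable_tsum hQ 0)).const_add (-1)

theorem differentiable_nevD (hP : LocallySquareSummable (P s)) : Differentiable ℂ (nevD s) :=
  differentiable_id.mul (hP.differentiable_tsum hP 0)

section Limits

variable {z : ℕ → ℂ} {a : ℂ}

theorem tendsto_polyCasorati_nevA (hp : PosDef s) (hQ : LocallySquareSummable (Q s))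
    (hz : Tendsto z atTop (𝓝 a)) :
    Tendsto (fun n => polyCasorati s (Q s) (Q s) n (z n) 0) atTop (𝓝 (nevA s a)) := by
  simp only [polyCasorati_Q_Q hp, sub_zero]
  exact hz.mul (hQ.tendsto_sum_range hQ hz tendsto_const_nhds (tendsto_add_atTop_nat 1))

theorem tendsto_polyCasorati_nevB (hp : PosDef s) (hs0 : s 0 = 1)
    (hP : LocallySquareSummable (P s)) (hQ : LocallySquareSummable (Q s))
    (hz : Tendsto z atTop (𝓝 a)) :
    Tendsto (fun n => polyCasorati s (P s) (Q s) n (z n) 0) atTop (𝓝 (nevB s a)) := by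
  simp only [polyCasorati_P_Q hp hs0, sub_zero]
  exact (hz.mul (hP.tendsto_sum_range hQ hz tendsto_const_nhds
    (tendsto_add_atTop_nat 1))).const_add (-1)

theorem tendsto_polyCasorati_nevC (hp : PosDef s) (hs0 : s 0 = 1)
    (hP : LocallySquareSummable (P s)) (hQ : LocallySquareSummable (Q s))
    (hz : Tendsto z atTop (𝓝 a)) :
    Tendsto (fun n => polyCasorati s (Q s) (P s) n (z n) 0) atTop (𝓝 (nevC s a)) := by
  simp only [polyCasorati_Q_P hp hs0, sub_zero]
  exact (hz.mul (hQ.tendsto_sum_range hP hz tendsto_const_nhds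
    (tendsto_add_atTop_nat 1))).const_add 1

theorem tendsto_polyCasorati_nevD (hp : PosDef s) (hs0 : s 0 = 1)
    (hP : LocallySquareSummable (P s)) (hz : Tendsto z atTop (𝓝 a)) :
    Tendsto (fun n => polyCasorati s (P s) (P s) n (z n) 0) atTop (𝓝 (nevD s a)) := by
  simp only [polyCasorati_P_P hp hs0, sub_zero]
  exact hz.mul (hP.tendsto_sum_range hP hz tendsto_const_nhds (tendsto_add_atTop_nat 1))

end Limits

theorem nevA_mul_nevD_sub_nevB_mul_nevC (hp : PosDef s) (hs0 : s 0 = 1)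
    (hP : LocallySquareSummable (P s)) (hQ : LocallySquareSummable (Q s)) (z : ℂ) :
    nevA s z * nevD s z - nevB s z * nevC s z = 1 := by
  have hz : Tendsto (fun _ : ℕ => z) atTop (𝓝 z) := tendsto_const_nhds
  have hlim := ((tendsto_polyCasorati_nevA hp hQ hz).mul
    (tendsto_polyCasorati_nevD hp hs0 hP hz)).sub
    ((tendsto_polyCasorati_nevB hp hs0 hP hQ hz).mul (tendsto_polyCasorati_nevC hp hs0 hP hQ hz))
  simp only [polyCasorati_det hp hs0] at hlim
  exact tendsto_nhds_unique hlim tendsto_const_nhds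

end Nevanlinna

/-! ### The Stieltjes transform -/

section StieltjesTransform

/-- The Stieltjes transform `z ↦ ∫ (t - z)⁻¹ dμ(t)` of a measure on the line. -/
def stieltjesTransform (μ : Measure ℝ) (z : ℂ) : ℂ := ∫ t : ℝ, ((t : ℂ) - z)⁻¹ ∂μ

/-- The distance from `z` to `μ`-almost every point is bounded below, so that multiplication by
`t - z` is boundedly invertible on `L²(μ)`. -/
def IsResolventPoint (μ : Measure ℝ) (z : ℂ) : Prop :=
  ∃ δ > 0, ∀ᵐ t : ℝ ∂μ, δ ≤ ‖(t : ℂ) - z‖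

variable {μ ν : Measure ℝ} {z : ℂ}

theorem isResolventPoint_of_im_ne_zero (μ : Measure ℝ) (hz : z.im ≠ 0) : IsResolventPoint μ z :=
  ⟨|z.im|, abs_pos.2 hz, .of_forall fun t => by
    simpa using Complex.abs_im_le_norm ((t : ℂ) - z)⟩

theorem ae_nonneg_of_measure_Iio (hμ : μ (Set.Iio 0) = 0) : ∀ᵐ t : ℝ ∂μ, 0 ≤ t := by
  filter_upwards [measure_eq_zero_iff_ae_notMem.1 hμ] with t ht using not_lt.1 ht

theorem isResolventPoint_of_re_neg (hμ : μ (Set.Iio 0) = 0) (hz : z.re < 0) :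
    IsResolventPoint μ z := by
  refine ⟨-z.re, neg_pos.2 hz, ?_⟩
  filter_upwards [ae_nonneg_of_measure_Iio hμ] with t ht
  calc -z.re ≤ ((t : ℂ) - z).re := by simpa using ht
    _ ≤ ‖(t : ℂ) - z‖ := Complex.re_le_norm _

theorem isResolventPoint_of_neg_mem_slitPlane (hμ : μ (Set.Iio 0) = 0)
    (hz : -z ∈ Complex.slitPlane) : IsResolventPoint μ z := by
  rcases Complex.mem_slitPlane_iff.1 hz with hre | him
  · exact isResolventPoint_of_re_neg hμ (by simpa using hre)
  · exact isResolventPoint_of_im_ne_zero μ (by simpa using him)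

theorem IsResolventPoint.ae_sub_ne_zero (hz : IsResolventPoint μ z) :
    ∀ᵐ t : ℝ ∂μ, (t : ℂ) - z ≠ 0 := by
  obtain ⟨δ, hδ, hae⟩ := hz
  filter_upwards [hae] with t ht using norm_pos_iff.1 (hδ.trans_le ht)

theorem IsResolventPoint.exists_norm_resolvent_le (hz : IsResolventPoint μ z) :
    ∃ M, ∀ᵐ t : ℝ ∂μ, ‖((t : ℂ) - z)⁻¹‖ ≤ M := by
  obtain ⟨δ, hδ, hae⟩ := hz
  refine ⟨δ⁻¹, ?_⟩
  filter_upwards [hae] with t ht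
  rw [norm_inv]
  exact inv_anti₀ hδ ht

theorem measurable_resolvent_pow (z : ℂ) (m : ℕ) :
    Measurable fun t : ℝ => (((t : ℂ) - z)⁻¹) ^ m := by fun_prop

theorem integrable_resolvent_pow [IsFiniteMeasure μ] (hz : IsResolventPoint μ z) (m : ℕ) :
    Integrable (fun t : ℝ => (((t : ℂ) - z)⁻¹) ^ m) μ := by
  obtain ⟨M, hM⟩ := hz.exists_norm_resolvent_le
  refine .of_bound (measurable_resolvent_pow z m).aestronglyMeasurable (M ^ m) ?_
  filter_upwards [hM] with t ht
  rw [norm_pow]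
  exact pow_le_pow_left₀ (norm_nonneg _) ht m

theorem hasDerivAt_resolvent_pow {t w : ℂ} (hne : t - w ≠ 0) (m : ℕ) :
    HasDerivAt (fun z => ((t - z)⁻¹) ^ m) (m * ((t - w)⁻¹) ^ (m + 1)) w := by
  have hinv : HasDerivAt (fun z => (t - z)⁻¹) ((t - w)⁻¹ ^ 2) w :=
    (((hasDerivAt_id w).const_sub t).inv hne).congr_deriv (by simp)
  refine (hinv.pow m).congr_deriv ?_
  rcases m with _ | m
  · simp
  · rw [Nat.add_sub_cancel]
    ring

theorem hasDerivAt_integral_resolvent_pow [IsFiniteMeasure μ] (hz : IsResolventPoint μ z) (m : ℕ) :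
    HasDerivAt (fun z => ∫ t : ℝ, (((t : ℂ) - z)⁻¹) ^ m ∂μ)
      (∫ t : ℝ, m * (((t : ℂ) - z)⁻¹) ^ (m + 1) ∂μ) z := by
  obtain ⟨δ, hδ, hae⟩ := id hz
  have hdist : ∀ t : ℝ, δ ≤ ‖(t : ℂ) - z‖ → ∀ w ∈ Metric.ball z (δ / 2),
      δ / 2 ≤ ‖(t : ℂ) - w‖ := by
    intro t ht w hw
    have hw' : ‖w - z‖ < δ / 2 := mem_ball_iff_norm.1 hw
    have htri := norm_sub_norm_le ((t : ℂ) - z) (w - z)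
    rw [sub_sub_sub_cancel_right] at htri
    linarith
  refine (hasDerivAt_integral_of_dominated_loc_of_deriv_le (s := Metric.ball z (δ / 2))
    (bound := fun _ => m * ((δ / 2)⁻¹) ^ (m + 1))
    (F' := fun z t => m * (((t : ℂ) - z)⁻¹) ^ (m + 1))
    (Metric.ball_mem_nhds z (half_pos hδ))
    (.of_forall fun w => (measurable_resolvent_pow w m).aestronglyMeasurable)
    (integrable_resolvent_pow hz m)
    ((measurable_resolvent_pow z (m + 1)).const_mul _).aestronglyMeasurable ?_
    (integrable_const _) ?_).2
  · filter_upwards [hae] with t ht w hw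
    have hd := hdist t ht w hw
    rw [norm_mul, norm_pow, norm_inv, Complex.norm_natCast]
    gcongr
  · filter_upwards [hae] with t ht w hw
    exact hasDerivAt_resolvent_pow (norm_pos_iff.1 ((half_pos hδ).trans_le (hdist t ht w hw))) m

theorem IsResolventPoint.differentiableAt_stieltjesTransform [IsFiniteMeasure μ]
    (hz : IsResolventPoint μ z) : DifferentiableAt ℂ (stieltjesTransform μ) z := by
  have hdiff := (hasDerivAt_integral_resolvent_pow hz 1).differentiableAt
  simp only [pow_one] at hdiff
  exact hdiff

theorem integral_resolvent_pow_eqOn [IsFiniteMeasure μ] [IsFiniteMeasure ν] {U : Set ℂ}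
    (hU : IsOpen U) (hμ : ∀ z ∈ U, IsResolventPoint μ z) (hν : ∀ z ∈ U, IsResolventPoint ν z)
    (h : Set.EqOn (stieltjesTransform μ) (stieltjesTransform ν) U) (m : ℕ) :
    Set.EqOn (fun z => ∫ t : ℝ, (((t : ℂ) - z)⁻¹) ^ (m + 1) ∂μ)
      (fun z => ∫ t : ℝ, (((t : ℂ) - z)⁻¹) ^ (m + 1) ∂ν) U := by
  induction m with
  | zero =>
    simp only [zero_add, pow_one]
    exact h
  | succ m ih =>
    intro z hz
    have hderiv := ((hasDerivAt_integral_resolvent_pow (hν z hz) (m + 1)).congr_of_eventuallyEq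
      (ih.eventuallyEq_of_mem (hU.mem_nhds hz))).unique
      (hasDerivAt_integral_resolvent_pow (hμ z hz) (m + 1))
    rw [integral_const_mul, integral_const_mul] at hderiv
    exact (mul_left_cancel₀ (Nat.cast_ne_zero.2 m.succ_ne_zero) hderiv).symm

theorem ofReal_sub_ne_zero (hz : z.im ≠ 0) (t : ℝ) : (t : ℂ) - z ≠ 0 :=
  fun h => hz (by simpa using congrArg Complex.im h)

/-- The function `t ↦ (t - i)⁻¹`, whose powers and their conjugates span a dense star algebra of
continuous functions vanishing at infinity. -/
def resolventI : BoundedContinuousFunction ℝ ℂ :=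
  .ofNormedAddCommGroup (fun t : ℝ => ((t : ℂ) - Complex.I)⁻¹)
    (.inv₀ (by fun_prop) (ofReal_sub_ne_zero (by simp))) 1 fun t => by
      rw [norm_inv]
      refine inv_le_one_of_one_le₀ ?_
      simpa using Complex.abs_im_le_norm ((t : ℂ) - Complex.I)

theorem resolventI_apply (t : ℝ) : resolventI t = ((t : ℂ) - Complex.I)⁻¹ := rfl

theorem star_resolventI_apply (t : ℝ) : star resolventI t = ((t : ℂ) - -Complex.I)⁻¹ := by
  change (starRingEnd ℂ) ((t : ℂ) - Complex.I)⁻¹ = _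
  simp

theorem resolventI_mul_star :
    resolventI * star resolventI = (2 * Complex.I)⁻¹ • (resolventI - star resolventI) := by
  ext t
  simp only [BoundedContinuousFunction.mul_apply, BoundedContinuousFunction.smul_apply,
    BoundedContinuousFunction.sub_apply, resolventI_apply, star_resolventI_apply, smul_eq_mul]
  have hI := ofReal_sub_ne_zero (z := Complex.I) (by simp) t
  have hI' := ofReal_sub_ne_zero (z := -Complex.I) (by simp) t
  field_simp
  ring

/-- The resolvent identity reduces mixed products to pure powers. -/
theorem integral_resolventI_pow_mul_star_pow_eq [IsFiniteMeasure μ] [IsFiniteMeasure ν]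
    (hpow : ∀ m, ∫ t, (resolventI ^ m) t ∂μ = ∫ t, (resolventI ^ m) t ∂ν)
    (hstar : ∀ m, ∫ t, (star resolventI ^ m) t ∂μ = ∫ t, (star resolventI ^ m) t ∂ν) (a b : ℕ) :
    ∫ t, (resolventI ^ a * star resolventI ^ b) t ∂μ =
      ∫ t, (resolventI ^ a * star resolventI ^ b) t ∂ν := by
  induction a generalizing b with
  | zero => simpa only [pow_zero, one_mul] using hstar b
  | succ a iha =>
    induction b with
    | zero => simpa only [pow_zero, mul_one] using hpow (a + 1)
    | succ b ihb =>
      have hred : resolventI ^ (a + 1) * star resolventI ^ (b + 1) = (2 * Complex.I)⁻¹ •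
          (resolventI ^ (a + 1) * star resolventI ^ b -
            resolventI ^ a * star resolventI ^ (b + 1)) := by
        rw [pow_succ, pow_succ, mul_mul_mul_comm, resolventI_mul_star, mul_smul_comm]
        congr 1
        ring
      simp only [hred, BoundedContinuousFunction.smul_apply, BoundedContinuousFunction.sub_apply,
        integral_smul]
      rw [integral_sub (BoundedContinuousFunction.integrable _ _)
        (BoundedContinuousFunction.integrable _ _), integral_sub
        (BoundedContinuousFunction.integrable _ _) (BoundedContinuousFunction.integrable _ _),
        ihb, iha]

theorem ext_of_integral_resolventI [IsFiniteMeasure μ] [IsFiniteMeasure ν]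
    (h : ∀ a b : ℕ, ∫ t, (resolventI ^ a * star resolventI ^ b) t ∂μ =
      ∫ t, (resolventI ^ a * star resolventI ^ b) t ∂ν) : μ = ν := by
  refine ext_of_forall_mem_subalgebra_integral_eq_of_pseudoEMetric_complete_countable (𝕜 := ℂ)
    (A := StarAlgebra.adjoin ℂ {resolventI}) ?_ fun g hg => ?_
  · intro x y hxy
    refine ⟨resolventI, ⟨resolventI.toContinuousMap,
      ⟨resolventI, StarAlgebra.self_mem_adjoin_singleton ℂ resolventI, rfl⟩, rfl⟩, fun h => hxy ?_⟩
    simpa [resolventI_apply] using h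
  · have hspan : g ∈ Submodule.span ℂ
        (Submonoid.closure ({resolventI, star resolventI} : Set (BoundedContinuousFunction ℝ ℂ)) :
          Set (BoundedContinuousFunction ℝ ℂ)) := by
      rw [← Algebra.adjoin_eq_span]
      have hg' : g ∈ (StarAlgebra.adjoin ℂ {resolventI}).toSubalgebra := hg
      rwa [StarAlgebra.adjoin_toSubalgebra, Set.star_singleton] at hg'
    clear hg
    induction hspan using Submodule.span_induction with
    | mem f hf =>
      obtain ⟨a, b, rfl⟩ := (Submonoid.mem_closure_pair _ _ _).1 hf
      exact h a b
    | zero => simp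
    | add f g _ _ hf hg =>
      simp only [BoundedContinuousFunction.add_apply]
      rw [integral_add, integral_add, hf, hg]
      all_goals exact BoundedContinuousFunction.integrable _ _
    | smul c f _ hf =>
      simp only [BoundedContinuousFunction.smul_apply, integral_smul, hf]

theorem ext_of_stieltjesTransform [IsFiniteMeasure μ] [IsFiniteMeasure ν]
    (h0 : μ.real Set.univ = ν.real Set.univ)
    (h : ∀ z : ℂ, z.im ≠ 0 → stieltjesTransform μ z = stieltjesTransform ν z) : μ = ν := by
  have hpow : ∀ z : ℂ, z.im ≠ 0 → ∀ m, ∫ t : ℝ, (((t : ℂ) - z)⁻¹) ^ m ∂μ =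
      ∫ t : ℝ, (((t : ℂ) - z)⁻¹) ^ m ∂ν := by
    rintro z hz (_ | m)
    · simp [h0]
    · exact integral_resolvent_pow_eqOn (isOpen_ne_fun Complex.continuous_im continuous_const)
        (fun _ => isResolventPoint_of_im_ne_zero μ) (fun _ => isResolventPoint_of_im_ne_zero ν)
        h m hz
  refine ext_of_integral_resolventI (integral_resolventI_pow_mul_star_pow_eq (fun m => ?_)
    fun m => ?_)
  · simpa only [BoundedContinuousFunction.pow_apply, resolventI_apply] using hpow _ (by simp) m
  · simpa only [BoundedContinuousFunction.pow_apply, star_resolventI_apply] using hpow _ (by simp) m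

theorem isPreconnected_neg_slitPlane : IsPreconnected {z : ℂ | -z ∈ Complex.slitPlane} := by
  have himage : {z : ℂ | -z ∈ Complex.slitPlane} = (fun z => -z) '' Complex.slitPlane := by
    ext z
    simp
  rw [himage]
  exact ((Complex.starConvex_one_slitPlane.isPathConnected
    Complex.one_mem_slitPlane).isConnected.isPreconnected).image _ continuous_neg.continuousOn

theorem tendsto_ofReal_nhdsNE (x : ℝ) : Tendsto ((↑) : ℝ → ℂ) (𝓝[≠] x) (𝓝[≠] (x : ℂ)) :=
  Complex.continuous_ofReal.continuousAt.continuousWithinAt.tendsto_nhdsWithin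
    fun _ hy => Complex.ofReal_injective.ne hy

/-- For measures on the half-line, analytic continuation from the negative axis reaches all
non-real points. -/
theorem ext_of_stieltjesTransform_neg [IsFiniteMeasure μ] [IsFiniteMeasure ν]
    (h0 : μ.real Set.univ = ν.real Set.univ) (hμ : μ (Set.Iio 0) = 0) (hν : ν (Set.Iio 0) = 0)
    (h : ∀ x : ℝ, x < 0 → stieltjesTransform μ x = stieltjesTransform ν x) : μ = ν := by
  have hopen : IsOpen {z : ℂ | -z ∈ Complex.slitPlane} :=
    Complex.isOpen_slitPlane.preimage continuous_neg
  have hanalytic : ∀ (κ : Measure ℝ) [IsFiniteMeasure κ], κ (Set.Iio 0) = 0 →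
      AnalyticOnNhd ℂ (stieltjesTransform κ) {z | -z ∈ Complex.slitPlane} := fun κ _ hκ =>
    DifferentiableOn.analyticOnNhd (fun z hz => (isResolventPoint_of_neg_mem_slitPlane hκ
      hz).differentiableAt_stieltjesTransform.differentiableWithinAt) hopen
  have hfreq : ∃ᶠ z in 𝓝[≠] ((-1 : ℝ) : ℂ), stieltjesTransform μ z = stieltjesTransform ν z := by
    refine (tendsto_ofReal_nhdsNE (-1)).frequently (Eventually.frequently ?_)
    filter_upwards [(eventually_lt_nhds (neg_lt_zero.2 one_pos)).filter_mono nhdsWithin_le_nhds]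
      with x hx using h x hx
  have heqOn := (hanalytic μ hμ).eqOn_of_preconnected_of_frequently_eq (hanalytic ν hν)
    isPreconnected_neg_slitPlane (by simp) hfreq
  exact ext_of_stieltjesTransform h0 fun z hz => heqOn (by simp [Complex.mem_slitPlane_iff, hz])

end StieltjesTransform

/-! ### The transform of the second kind -/

section SecondKind

/-- `secondKind s p` is the polynomial `x ↦ L_t ((p(t) - p(x)) / (t - x))`, where `L` is the moment
functional of `s` acting on the variable `t`. It maps `P s n` to `Q s n`. -/
def secondKind (s : ℕ → ℝ) : ℝ[X] →ₗ[ℝ] ℝ[X] :=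
  lsum fun n => LinearMap.toSpanSingleton ℝ ℝ[X] (∑ i ∈ Finset.range n, C (s i) * X ^ (n - 1 - i))

theorem secondKind_X_pow (s : ℕ → ℝ) (n : ℕ) :
    secondKind s (X ^ n) = ∑ i ∈ Finset.range n, C (s i) * X ^ (n - 1 - i) := by
  rw [secondKind, lsum_apply, ← monomial_one_right_eq_X_pow, sum_monomial_index _ _ (by simp)]
  simp

theorem secondKind_X_pow_succ (s : ℕ → ℝ) (n : ℕ) :
    secondKind s (X ^ (n + 1)) = X * secondKind s (X ^ n) + C (s n) := by
  rw [secondKind_X_pow, secondKind_X_pow, Finset.sum_range_succ, Finset.mul_sum]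
  congr 1
  · refine Finset.sum_congr rfl fun i hi => ?_
    have hexp : n + 1 - 1 - i = n - 1 - i + 1 := by
      have := Finset.mem_range.1 hi
      omega
    rw [hexp, pow_succ]
    ring
  · simp

theorem secondKind_one (s : ℕ → ℝ) : secondKind s 1 = 0 := by
  simpa using secondKind_X_pow s 0

theorem secondKind_C_mul (s : ℕ → ℝ) (c : ℝ) (p : ℝ[X]) :
    secondKind s (C c * p) = C c * secondKind s p := by
  rw [← smul_eq_C_mul, map_smul, smul_eq_C_mul]

theorem secondKind_X_mul (s : ℕ → ℝ) (p : ℝ[X]) :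
    secondKind s (X * p) = X * secondKind s p + C (momentFun s p) := by
  induction p using Polynomial.induction_on' with
  | add p q hp hq => rw [mul_add, map_add, map_add, hp, hq, momentFun_add, C_add]; ring
  | monomial n a =>
    rw [← smul_X_eq_monomial, mul_smul_comm, ← pow_succ', map_smul, map_smul,
      secondKind_X_pow_succ, smul_eq_C_mul, smul_eq_C_mul, smul_eq_C_mul, momentFun_C_mul,
      momentFun_X_pow, C_mul]
    ring

variable {s : ℕ → ℝ}

theorem secondKind_P (hp : PosDef s) (hs0 : s 0 = 1) (n : ℕ) : secondKind s (P s n) = Q s n := by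
  have hb : ∀ k, C (jacobiB s k) ≠ 0 := fun k => C_ne_zero.2 (jacobiB_pos hp k).ne'
  induction n using Nat.twoStepInduction with
  | zero => rw [P_zero hs0, secondKind_one, Q]
  | one =>
    have hX := congrArg (secondKind s) (X_mul_P_zero hp)
    rw [map_add, secondKind_C_mul, secondKind_C_mul, secondKind_X_mul, P_zero hs0,
      secondKind_one, momentFun_one, hs0, C_1] at hX
    refine mul_left_cancel₀ (hb 0) ?_
    linear_combination -hX - C_jacobiB_mul_Q_one hp
  | more n ih₀ ih₁ =>
    have hX := congrArg (secondKind s) (X_mul_P_succ hp n)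
    rw [map_add, map_add, secondKind_C_mul, secondKind_C_mul, secondKind_C_mul, secondKind_X_mul,
      momentFun_P_succ hp, C_0, ih₀, ih₁] at hX
    refine mul_left_cancel₀ (hb (n + 1)) ?_
    linear_combination isJacobiRec_Q hp n - hX

theorem map_eq_aeval_secondKind {K : Type*} [CommRing K] [Algebra ℝ K] {T : ℝ[X] →ₗ[ℝ] K} {z : K}
    {N : ℕ} (hT : ∀ m < N, T (X ^ (m + 1)) = z * T (X ^ m) + algebraMap ℝ K (s m)) {p : ℝ[X]}
    (hp : p.natDegree ≤ N) : T p = aeval z (secondKind s p) + aeval z p * T 1 := by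
  have hpow : ∀ m ≤ N, T (X ^ m) = aeval z (secondKind s (X ^ m)) + z ^ m * T 1 := by
    intro m
    induction m with
    | zero => simp [secondKind_one]
    | succ m ih =>
      intro hm
      rw [hT m hm, ih (Nat.le_of_succ_le hm), secondKind_X_pow_succ]
      simp only [map_add, map_mul, aeval_X, aeval_C]
      ring
  rw [p.as_sum_range' (N + 1) (Nat.lt_succ_of_le hp)]
  simp only [← smul_X_eq_monomial, map_sum, map_smul, Finset.sum_mul, ← Finset.sum_add_distrib]
  refine Finset.sum_congr rfl fun m hm => ?_
  rw [hpow m (Finset.mem_range_succ_iff.1 hm), smul_add, smul_mul_assoc, map_pow (aeval z), aeval_X]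

end SecondKind

/-! ### Solutions of the moment problem -/

section Solutions

variable {s : ℕ → ℝ} {μ ν : Measure ℝ}

theorem IsSolution.isFiniteMeasure (h : IsSolution s μ) : IsFiniteMeasure μ := by
  have hone := (h 0).1
  simp only [pow_zero] at hone
  exact (integrable_const_iff_isFiniteMeasure one_ne_zero).1 hone

theorem IsSolution.real_univ (h : IsSolution s μ) : μ.real Set.univ = s 0 := by
  simpa using (h 0).2

theorem IsSolution.integrable_eval (h : IsSolution s μ) (p : ℝ[X]) :
    Integrable (fun t => p.eval t) μ := by
  simp only [eval_eq_sum, Polynomial.sum]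
  exact integrable_finsetSum _ fun n _ => (h n).1.const_mul _

theorem IsSolution.integral_eval (h : IsSolution s μ) (p : ℝ[X]) :
    ∫ t, p.eval t ∂μ = momentFun s p := by
  simp only [eval_eq_sum, Polynomial.sum, momentFun]
  rw [integral_finsetSum _ fun n _ => (h n).1.const_mul _]
  simp only [integral_const_mul, (h _).2]

theorem IsSolution.memLp_two_eval (h : IsSolution s μ) (p : ℝ[X]) :
    MemLp (fun t => p.eval t) 2 μ := by
  refine (memLp_two_iff_integrable_sq p.continuous.aestronglyMeasurable).2 ?_
  exact (h.integrable_eval (p ^ 2)).congr (.of_forall fun t => eval_pow 2)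

theorem IsSolution.integral_eq_of_ae_mem_finset (h : IsSolution s μ) {S : Finset ℝ}
    (hS : ∀ᵐ t ∂μ, t ∈ S) (f : ℝ → ℝ) :
    ∫ t, f t ∂μ = momentFun s (Lagrange.interpolate S id f) := by
  rw [← h.integral_eval]
  refine integral_congr_ae ?_
  filter_upwards [hS] with t ht
    using (Lagrange.eval_interpolate_at_node f (Set.injOn_id _) ht).symm

theorem IsSolution.eq_of_ae_mem_finset (hμ : IsSolution s μ) (hν : IsSolution s ν) {S : Finset ℝ}
    (hμS : ∀ᵐ t ∂μ, t ∈ S) (hνS : ∀ᵐ t ∂ν, t ∈ S) : μ = ν := by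
  have := hμ.isFiniteMeasure
  have := hν.isFiniteMeasure
  refine ext_of_forall_integral_eq_of_IsFiniteMeasure fun f => ?_
  rw [hμ.integral_eq_of_ae_mem_finset hμS, hν.integral_eq_of_ae_mem_finset hνS]

/-- The moment functional is strictly positive on the nonzero polynomials that are nonnegative on
the half-line: the Stieltjes counterpart of `PosDef`. -/
def PosDefS (s : ℕ → ℝ) : Prop :=
  ∀ p : ℝ[X], (∀ t, 0 ≤ t → 0 ≤ p.eval t) → p ≠ 0 → 0 < momentFun s p

theorem PosDefS.posDef (hs : PosDefS s) : PosDef s := fun p hp =>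
  hs _ (fun t _ => by rw [eval_mul]; exact mul_self_nonneg _) (mul_self_ne_zero.2 hp)

theorem ae_eval_nonneg (hμ : μ (Set.Iio 0) = 0) {p : ℝ[X]} (hp : ∀ t, 0 ≤ t → 0 ≤ p.eval t) :
    ∀ᵐ t ∂μ, 0 ≤ p.eval t := by
  filter_upwards [ae_nonneg_of_measure_Iio hμ] with t ht using hp t ht

theorem IsSolution.ae_mem_roots (h : IsSolution s μ) (hμ : μ (Set.Iio 0) = 0) {p : ℝ[X]}
    (hp : ∀ t, 0 ≤ t → 0 ≤ p.eval t) (hp0 : p ≠ 0) (hmom : momentFun s p = 0) :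
    ∀ᵐ t ∂μ, t ∈ p.roots.toFinset := by
  have hzero := (integral_eq_zero_iff_of_nonneg_ae (ae_eval_nonneg hμ hp) (h.integrable_eval p)).1
    (by rw [h.integral_eval, hmom])
  filter_upwards [hzero] with t ht
  rw [Multiset.mem_toFinset, mem_roots hp0]
  exact ht

theorem IndetS.posDefS (hs : IndetS s) : PosDefS s := by
  obtain ⟨μ₁, μ₂, h₁, h₂, hμ₁, hμ₂, hne⟩ := hs
  intro p hp hp0
  have hnonneg : 0 ≤ momentFun s p := by
    rw [← h₁.integral_eval]
    exact integral_nonneg_of_ae (ae_eval_nonneg hμ₁ hp)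
  exact hnonneg.lt_of_ne fun h => hne (h₁.eq_of_ae_mem_finset h₂
    (h₁.ae_mem_roots hμ₁ hp hp0 h.symm) (h₂.ae_mem_roots hμ₂ hp hp0 h.symm))

/-! ### Bessel's inequality and functions of the second kind -/

theorem momentFun_sum_C_mul_P_mul_self (hp : PosDef s) (c : ℕ → ℝ) (n : ℕ) :
    momentFun s ((∑ k ∈ Finset.range n, C (c k) * P s k) *
      ∑ k ∈ Finset.range n, C (c k) * P s k) = ∑ k ∈ Finset.range n, c k ^ 2 := by
  have hterm : ∀ k i, momentFun s (C (c k) * P s k * (C (c i) * P s i)) =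
      if k = i then c k * c i else 0 := fun k i => by
    rw [mul_mul_mul_comm, ← C_mul, momentFun_C_mul, momentFun_P_mul_P hp, mul_ite, mul_one,
      mul_zero]
  rw [Finset.sum_mul_sum, momentFun_sum]
  refine Finset.sum_congr rfl fun k hk => ?_
  rw [momentFun_sum]
  simp only [hterm]
  rw [Finset.sum_ite_eq, if_pos hk, sq]

theorem IsSolution.bessel (hp : PosDef s) (h : IsSolution s μ) {f : ℝ → ℝ} (hf : MemLp f 2 μ)
    (n : ℕ) : ∑ k ∈ Finset.range n, (∫ t, (P s k).eval t * f t ∂μ) ^ 2 ≤ ∫ t, f t ^ 2 ∂μ := by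
  set c : ℕ → ℝ := fun k => ∫ t, (P s k).eval t * f t ∂μ with hc
  set g : ℝ[X] := ∑ k ∈ Finset.range n, C (c k) * P s k with hg
  have hint : ∀ p : ℝ[X], Integrable (fun t => p.eval t * f t) μ := fun p =>
    (h.memLp_two_eval p).integrable_mul hf
  have hgf : ∫ t, g.eval t * f t ∂μ = ∑ k ∈ Finset.range n, c k ^ 2 := by
    simp only [hg, eval_finsetSum, Finset.sum_mul, eval_mul, eval_C, mul_assoc]
    rw [integral_finsetSum _ fun k _ => (hint (P s k)).const_mul _]
    simp only [integral_const_mul, sq, hc]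
  have hgg : ∫ t, (g * g).eval t ∂μ = ∑ k ∈ Finset.range n, c k ^ 2 := by
    rw [h.integral_eval, hg, momentFun_sum_C_mul_P_mul_self hp]
  have hexpand : ∫ t, (f t - g.eval t) ^ 2 ∂μ =
      ∫ t, f t ^ 2 ∂μ - 2 * ∫ t, g.eval t * f t ∂μ + ∫ t, (g * g).eval t ∂μ := by
    have hsub : Integrable (fun t => f t ^ 2 - 2 * (g.eval t * f t)) μ :=
      hf.integrable_sq.sub ((hint g).const_mul 2)
    rw [← integral_const_mul, ← integral_sub hf.integrable_sq ((hint g).const_mul 2),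
      ← integral_add hsub (h.integrable_eval _)]
    refine integral_congr_ae (.of_forall fun t => ?_)
    simp only [eval_mul]
    ring
  have hnonneg : 0 ≤ ∫ t, (f t - g.eval t) ^ 2 ∂μ := integral_nonneg fun t => sq_nonneg _
  linarith

theorem IsSolution.summable_sq_integral_P_mul (hp : PosDef s) (h : IsSolution s μ) {f : ℝ → ℝ}
    (hf : MemLp f 2 μ) : Summable fun n => (∫ t, (P s n).eval t * f t ∂μ) ^ 2 :=
  summable_of_sum_range_le (fun _ => sq_nonneg _) (h.bessel hp hf)

theorem IsSolution.summable_norm_sq_integral_P_mul (hp : PosDef s) (h : IsSolution s μ) {f : ℝ → ℂ}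
    (hf : MemLp f 2 μ) : Summable fun n => ‖∫ t, (((P s n).eval t : ℝ) : ℂ) * f t ∂μ‖ ^ 2 := by
  have hint : ∀ n, Integrable (fun t => (((P s n).eval t : ℝ) : ℂ) * f t) μ := fun n =>
    ((h.memLp_two_eval (P s n)).ofReal (K := ℂ)).integrable_mul hf
  refine ((h.summable_sq_integral_P_mul hp hf.re).add
    (h.summable_sq_integral_P_mul hp hf.im)).congr fun n => ?_
  have hre := integral_re (𝕜 := ℂ) (hint n)
  have him := integral_im (𝕜 := ℂ) (hint n)
  simp only [RCLike.re_to_complex, RCLike.im_to_complex, Complex.re_ofReal_mul,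
    Complex.im_ofReal_mul] at hre him ⊢
  rw [hre, him, Complex.sq_norm, Complex.normSq_apply, sq, sq]

variable {z : ℂ}

theorem IsResolventPoint.memLp_resolvent [IsFiniteMeasure μ] (hz : IsResolventPoint μ z)
    (p : ENNReal) : MemLp (fun t : ℝ => ((t : ℂ) - z)⁻¹) p μ := by
  obtain ⟨M, hM⟩ := hz.exists_norm_resolvent_le
  have hmeas := measurable_resolvent_pow z 1
  simp only [pow_one] at hmeas
  exact .of_bound hmeas.aestronglyMeasurable M hM

theorem IsSolution.integrable_mul_resolvent (h : IsSolution s μ) (hz : IsResolventPoint μ z)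
    (p : ℝ[X]) : Integrable (fun t : ℝ => ((p.eval t : ℝ) : ℂ) * ((t : ℂ) - z)⁻¹) μ :=
  have := h.isFiniteMeasure
  ((h.memLp_two_eval p).ofReal (K := ℂ)).integrable_mul (hz.memLp_resolvent 2)

theorem IsSolution.integral_eval_mul_resolvent (h : IsSolution s μ) (hz : IsResolventPoint μ z)
    (p : ℝ[X]) : ∫ t : ℝ, ((p.eval t : ℝ) : ℂ) * ((t : ℂ) - z)⁻¹ ∂μ =
      aeval z (secondKind s p) + aeval z p * stieltjesTransform μ z := by
  have hint := h.integrable_mul_resolvent hz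
  let T : ℝ[X] →ₗ[ℝ] ℂ :=
    { toFun := fun p => ∫ t : ℝ, ((p.eval t : ℝ) : ℂ) * ((t : ℂ) - z)⁻¹ ∂μ
      map_add' := fun p q => by
        rw [← integral_add (hint p) (hint q)]
        simp only [eval_add, Complex.ofReal_add, add_mul]
      map_smul' := fun c p => by
        rw [← integral_smul]
        simp only [eval_smul, smul_eq_mul, Complex.ofReal_mul, Complex.real_smul, mul_assoc,
          RingHom.id_apply] }
  have hT : ∀ m, T (X ^ (m + 1)) = z * T (X ^ m) + algebraMap ℝ ℂ (s m) := by
    intro m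
    have hpow : Integrable (fun t => (((X ^ m : ℝ[X]).eval t : ℝ) : ℂ)) μ :=
      (h.integrable_eval _).ofReal
    simp only [T, LinearMap.coe_mk, AddHom.coe_mk, Complex.coe_algebraMap]
    rw [← momentFun_X_pow s m, ← h.integral_eval, ← integral_complex_ofReal, ← integral_const_mul,
      ← integral_add ((hint _).const_mul z) hpow]
    refine integral_congr_ae ?_
    filter_upwards [hz.ae_sub_ne_zero] with t ht
    simp only [eval_pow, eval_X, Complex.ofReal_pow]
    field_simp
    ring
  have hT1 : T 1 = stieltjesTransform μ z := by
    simp only [T, LinearMap.coe_mk, AddHom.coe_mk, eval_one, Complex.ofReal_one, one_mul,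
      stieltjesTransform]
  rw [← hT1, ← map_eq_aeval_secondKind (fun m _ => hT m) le_rfl]
  rfl

theorem IsSolution.summable_norm_sq_add_mul_stieltjesTransform (hp : PosDef s) (hs0 : s 0 = 1)
    (h : IsSolution s μ) (hz : IsResolventPoint μ z) :
    Summable fun n => ‖aeval z (Q s n) + aeval z (P s n) * stieltjesTransform μ z‖ ^ 2 := by
  have := h.isFiniteMeasure
  refine (h.summable_norm_sq_integral_P_mul hp (hz.memLp_resolvent 2)).congr fun n => ?_
  rw [h.integral_eval_mul_resolvent hz, secondKind_P hp hs0]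

theorem summable_norm_sq_linear_combination {f g : ℕ → ℂ} (hf : Summable fun n => ‖f n‖ ^ 2)
    (hg : Summable fun n => ‖g n‖ ^ 2) (a b : ℂ) : Summable fun n => ‖a * f n + b * g n‖ ^ 2 := by
  refine (((hf.mul_left (‖a‖ ^ 2)).add (hg.mul_left (‖b‖ ^ 2))).mul_left 2).of_nonneg_of_le
    (fun n => by positivity) fun n => ?_
  calc ‖a * f n + b * g n‖ ^ 2 ≤ (‖a‖ * ‖f n‖ + ‖b‖ * ‖g n‖) ^ 2 := by
        rw [← norm_mul, ← norm_mul]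
        gcongr
        exact norm_add_le _ _
    _ ≤ 2 * ((‖a‖ * ‖f n‖) ^ 2 + (‖b‖ * ‖g n‖) ^ 2) := add_sq_le
    _ = 2 * (‖a‖ ^ 2 * ‖f n‖ ^ 2 + ‖b‖ ^ 2 * ‖g n‖ ^ 2) := by ring

/-- Two solutions with different Stieltjes transforms `w₁ ≠ w₂` at `z` give two independent square
summable combinations `Q_n(z) + w_i P_n(z)`. -/
theorem IndetS.locallySquareSummable (hs : IndetS s) (hs0 : s 0 = 1) :
    LocallySquareSummable (P s) ∧ LocallySquareSummable (Q s) := by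
  have hp := hs.posDefS.posDef
  obtain ⟨μ₁, μ₂, h₁, h₂, -, -, hne⟩ := hs
  have := h₁.isFiniteMeasure
  have := h₂.isFiniteMeasure
  obtain ⟨z, hz, hw⟩ : ∃ z : ℂ, z.im ≠ 0 ∧
      stieltjesTransform μ₁ z ≠ stieltjesTransform μ₂ z := by
    by_contra! hcon
    exact hne (ext_of_stieltjesTransform (by rw [h₁.real_univ, h₂.real_univ]) hcon)
  have hsum₁ := h₁.summable_norm_sq_add_mul_stieltjesTransform hp hs0
    (isResolventPoint_of_im_ne_zero μ₁ hz)
  have hsum₂ := h₂.summable_norm_sq_add_mul_stieltjesTransform hp hs0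
    (isResolventPoint_of_im_ne_zero μ₂ hz)
  set w₁ := stieltjesTransform μ₁ z
  set w₂ := stieltjesTransform μ₂ z
  have hw' : w₁ - w₂ ≠ 0 := sub_ne_zero.2 hw
  refine locallySquareSummable_P_and_Q hp hs0 (w := z)
    ((summable_norm_sq_linear_combination hsum₁ hsum₂ (w₁ - w₂)⁻¹ (-(w₁ - w₂)⁻¹)).congr fun n => ?_)
    ((summable_norm_sq_linear_combination hsum₁ hsum₂ (-w₂ * (w₁ - w₂)⁻¹)
      (w₁ * (w₁ - w₂)⁻¹)).congr fun n => ?_)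
  all_goals
    congr 2
    field_simp
    ring

end Solutions

/-! ### The reproducing kernel -/

section Kernel

variable {s : ℕ → ℝ} {n : ℕ}

/-- The Christoffel-Darboux kernel `y ↦ ∑_{k<n} P_k(x) P_k(y)`, the reproducing kernel of the
polynomials of degree less than `n`. -/
def kernelPoly (s : ℕ → ℝ) (n : ℕ) (x : ℝ) : ℝ[X] :=
  ∑ k ∈ Finset.range n, C ((P s k).eval x) * P s k

theorem eval_kernelPoly (s : ℕ → ℝ) (n : ℕ) (x y : ℝ) :
    (kernelPoly s n x).eval y = ∑ k ∈ Finset.range n, (P s k).eval x * (P s k).eval y := by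
  simp only [kernelPoly, eval_finsetSum, eval_mul, eval_C]

theorem degree_kernelPoly_lt (hp : PosDef s) (n : ℕ) (x : ℝ) : (kernelPoly s n x).degree < n := by
  refine (degree_sum_le _ _).trans_lt ((Finset.sup_lt_iff (WithBot.bot_lt_coe n)).2 fun k hk => ?_)
  rw [← smul_eq_C_mul]
  exact (degree_smul_le _ _).trans_lt
    (degree_P hp k ▸ Nat.cast_lt.2 (Finset.mem_range.1 hk))

theorem momentFun_mul_kernelPoly (hp : PosDef s) {q : ℝ[X]} (hq : q.degree < n) (x : ℝ) :
    momentFun s (q * kernelPoly s n x) = q.eval x := by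
  conv_rhs => rw [eq_sum_momentFun_mul_P hp hq, eval_finsetSum]
  rw [kernelPoly, Finset.mul_sum, momentFun_sum]
  refine Finset.sum_congr rfl fun k _ => ?_
  rw [mul_left_comm, momentFun_C_mul, eval_mul, eval_C, mul_comm]

theorem momentFun_kernelPoly (hp : PosDef s) (hn : 0 < n) (x : ℝ) :
    momentFun s (kernelPoly s n x) = 1 := by
  have hone : (1 : ℝ[X]).degree < n := degree_one_le.trans_lt (by exact_mod_cast hn)
  rw [← one_mul (kernelPoly s n x), momentFun_mul_kernelPoly hp hone, eval_one]

theorem one_le_eval_kernelPoly_self (hs0 : s 0 = 1) (hn : 0 < n) (x : ℝ) :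
    1 ≤ (kernelPoly s n x).eval x := by
  have hle := Finset.single_le_sum (f := fun k => (P s k).eval x * (P s k).eval x)
    (fun k _ => mul_self_nonneg _) (Finset.mem_range.2 hn)
  rw [eval_kernelPoly]
  simpa only [P_zero hs0, eval_one, mul_one] using hle

theorem X_sub_C_mul_kernelPoly (hp : PosDef s) (hs0 : s 0 = 1) (n : ℕ) (x : ℝ) :
    (X - C x) * kernelPoly s (n + 1) x =
      C (jacobiB s n) * (P s (n + 1) * C ((P s n).eval x) - P s n * C ((P s (n + 1)).eval x)) := by
  have haeval : ∀ p : ℝ[X], aeval (C x) p = C (p.eval x) := fun p => by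
    rw [← algebraMap_eq, aeval_algebraMap_apply, coe_aeval_eq_eval]
  have hCD := polyCasorati_P_P hp hs0 (X : ℝ[X]) (C x) n
  simp only [polyCasorati, casorati, aeval_X_left_apply, haeval, algebraMap_eq] at hCD
  rw [hCD, kernelPoly]
  simp only [mul_comm]

theorem jacobiB_mul_eval_wronskian_P (hp : PosDef s) (hs0 : s 0 = 1) (n : ℕ) (x : ℝ) :
    jacobiB s n * (wronskian (P s n) (P s (n + 1))).eval x = (kernelPoly s (n + 1) x).eval x := by
  have hCD := congrArg (fun p => p.derivative.eval x) (X_sub_C_mul_kernelPoly hp hs0 n x)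
  simp only [derivative_mul, derivative_sub, derivative_C, derivative_X, eval_mul, eval_add,
    eval_sub, eval_C, eval_X, eval_zero, eval_one] at hCD
  rw [wronskian, eval_sub, eval_mul, eval_mul]
  linear_combination -hCD

theorem eval_wronskian_P_pos (hp : PosDef s) (hs0 : s 0 = 1) (n : ℕ) (x : ℝ) :
    0 < (wronskian (P s n) (P s (n + 1))).eval x := by
  refine pos_of_mul_pos_right ?_ (jacobiB_pos hp n).le
  rw [jacobiB_mul_eval_wronskian_P hp hs0]
  exact one_pos.trans_le (one_le_eval_kernelPoly_self hs0 n.succ_pos x)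

end Kernel

/-! ### Zeros of the orthonormal polynomials -/

section Zeros

variable {s : ℕ → ℝ} {n : ℕ}

theorem aeval_star (p : ℝ[X]) (z : ℂ) : aeval (starRingEnd ℂ z) p = starRingEnd ℂ (aeval z p) :=
  aeval_algHom_apply (Complex.conjAe : ℂ →ₐ[ℝ] ℂ) z p

theorem im_eq_zero_of_aeval_P (hp : PosDef s) (hs0 : s 0 = 1) {z : ℂ} (hz : aeval z (P s n) = 0) :
    z.im = 0 := by
  obtain - | n := n
  · simp [aeval_P_zero hs0] at hz
  have hCD := polyCasorati_P_P hp hs0 z (starRingEnd ℂ z) n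
  have hnorm : ∀ k, aeval z (P s k) * starRingEnd ℂ (aeval z (P s k)) =
      ((‖aeval z (P s k)‖ ^ 2 : ℝ) : ℂ) := fun k => by
    rw [Complex.mul_conj, Complex.normSq_eq_norm_sq]
  simp only [polyCasorati, casorati, aeval_star, hz, map_zero, zero_mul, mul_zero, sub_zero, hnorm,
    ← Complex.ofReal_sum, zero_eq_mul, Complex.sub_conj, Complex.ofReal_eq_zero] at hCD
  refine hCD.elim (fun him => by simpa using him) fun hsum => ?_
  have hle := Finset.single_le_sum (f := fun k => ‖aeval z (P s k)‖ ^ 2) (fun k _ => sq_nonneg _)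
    (Finset.mem_range.2 n.succ_pos)
  simp only [hsum, aeval_P_zero hs0, norm_one, one_pow] at hle
  exact absurd hle one_pos.not_ge

theorem splits_P (hp : PosDef s) (hs0 : s 0 = 1) (n : ℕ) : (P s n).Splits := by
  refine Splits.of_splits_map (algebraMap ℝ ℂ) (IsAlgClosed.splits _) fun z hz => ?_
  rw [mem_roots ((Polynomial.map_ne_zero_iff (algebraMap ℝ ℂ).injective).2 (P_ne_zero hp n)),
    IsRoot, eval_map_algebraMap] at hz
  exact ⟨z.re, Complex.ext rfl (by simpa using (im_eq_zero_of_aeval_P hp hs0 hz).symm)⟩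

theorem card_roots_P (hp : PosDef s) (hs0 : s 0 = 1) (n : ℕ) : (P s n).roots.card = n := by
  rw [← (splits_P hp hs0 n).natDegree_eq_card_roots, natDegree_P hp]

theorem nodup_roots_P (hp : PosDef s) (hs0 : s 0 = 1) (n : ℕ) : (P s n).roots.Nodup := by
  obtain - | n := n
  · simp [P_zero hs0]
  refine Multiset.nodup_iff_count_le_one.2 fun x => ?_
  rw [count_roots]
  by_contra! hmult
  obtain ⟨hx, hx'⟩ := (one_lt_rootMultiplicity_iff_isRoot (P_ne_zero hp (n + 1))).1 hmult
  have hpos := eval_wronskian_P_pos hp hs0 n x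
  rw [wronskian, eval_sub, eval_mul, eval_mul, hx.eq_zero, hx'.eq_zero] at hpos
  simp at hpos

theorem length_sort_roots_P (hp : PosDef s) (hs0 : s 0 = 1) (n : ℕ) :
    ((P s n).roots.sort (· ≤ ·)).length = n := by
  rw [Multiset.length_sort, card_roots_P hp hs0]

variable {j k : ℕ}

theorem polyZero_eq_getElem (hp : PosDef s) (hs0 : s 0 = 1) (hk : k < n) :
    polyZero s n k =
      ((P s n).roots.sort (· ≤ ·))[k]'(by rwa [length_sort_roots_P hp hs0]) := by
  rw [polyZero, List.getD_eq_getElem]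

theorem eval_polyZero (hp : PosDef s) (hs0 : s 0 = 1) (hk : k < n) :
    (P s n).eval (polyZero s n k) = 0 := by
  have hmem := List.getElem_mem (l := (P s n).roots.sort (· ≤ ·)) (n := k)
    (by rwa [length_sort_roots_P hp hs0])
  rwa [Multiset.mem_sort, mem_roots (P_ne_zero hp n), ← polyZero_eq_getElem hp hs0 hk] at hmem

theorem exists_polyZero_eq (hp : PosDef s) (hs0 : s 0 = 1) {x : ℝ} (hx : (P s n).eval x = 0) :
    ∃ k < n, polyZero s n k = x := by
  have hmem : x ∈ (P s n).roots.sort (· ≤ ·) := by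
    rwa [Multiset.mem_sort, mem_roots (P_ne_zero hp n)]
  obtain ⟨k, hk, h⟩ := List.getElem_of_mem hmem
  rw [length_sort_roots_P hp hs0] at hk
  exact ⟨k, hk, by rw [polyZero_eq_getElem hp hs0 hk, h]⟩

theorem polyZero_lt_polyZero (hp : PosDef s) (hs0 : s 0 = 1) (hjk : j < k) (hk : k < n) :
    polyZero s n j < polyZero s n k := by
  have hnodup : ((P s n).roots.sort (· ≤ ·)).Nodup := by
    rw [← Multiset.coe_nodup, Multiset.sort_eq]
    exact nodup_roots_P hp hs0 n
  have hsorted := List.pairwise_iff_getElem.1 ((P s n).roots.pairwise_sort (· ≤ ·))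
  rw [polyZero_eq_getElem hp hs0 hk, polyZero_eq_getElem hp hs0 (hjk.trans hk)]
  exact (hsorted j k _ _ hjk).lt_of_ne fun h => hjk.ne (hnodup.getElem_inj_iff.1 h)

theorem polyZero_le_polyZero (hp : PosDef s) (hs0 : s 0 = 1) (hjk : j ≤ k) (hk : k < n) :
    polyZero s n j ≤ polyZero s n k := by
  rcases hjk.eq_or_lt with rfl | h
  · exact le_rfl
  · exact (polyZero_lt_polyZero hp hs0 h hk).le

theorem injOn_polyZero (hp : PosDef s) (hs0 : s 0 = 1) (n : ℕ) :
    Set.InjOn (polyZero s n) (Finset.range n) := by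
  intro j hj k hk h
  rw [Finset.coe_range] at hj hk
  rcases lt_trichotomy j k with hjk | hjk | hjk
  · exact absurd h (polyZero_lt_polyZero hp hs0 hjk hk).ne
  · exact hjk
  · exact absurd h (polyZero_lt_polyZero hp hs0 hjk hj).ne'

/-- By the Wronskian inequality `P_{n+1} / P_n` has positive derivative, so Rolle's theorem forbids
that `P_n` has no zero between two zeros of `P_{n+1}`. -/
theorem exists_eval_P_eq_zero_between (hp : PosDef s) (hs0 : s 0 = 1) {x y : ℝ} (hxy : x < y)
    (hx : (P s (n + 1)).eval x = 0) (hy : (P s (n + 1)).eval y = 0) :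
    ∃ z ∈ Set.Ioo x y, (P s n).eval z = 0 := by
  by_contra! hcon
  have hW := eval_wronskian_P_pos hp hs0 n
  simp only [wronskian, eval_sub, eval_mul] at hW
  have hend : ∀ w, (P s (n + 1)).eval w = 0 → (P s n).eval w ≠ 0 := fun w hw h => by
    simpa [hw, h] using hW w
  have hne : ∀ w ∈ Set.Icc x y, (P s n).eval w ≠ 0 := fun w hw => by
    rcases hw.1.eq_or_lt with rfl | hxw
    · exact hend _ hx
    rcases hw.2.eq_or_lt with rfl | hwy
    · exact hend _ hy
    exact hcon w ⟨hxw, hwy⟩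
  obtain ⟨c, hc, hc0⟩ := exists_hasDerivAt_eq_zero hxy
    ((P s (n + 1)).continuous.continuousOn.div (P s n).continuous.continuousOn hne)
    (by rw [Pi.div_apply, Pi.div_apply, hx, hy, zero_div, zero_div])
    (fun w hw => ((P s (n + 1)).hasDerivAt w).div ((P s n).hasDerivAt w)
      (hne w (Set.Ioo_subset_Icc_self hw)))
  rw [div_eq_zero_iff, or_iff_left (pow_ne_zero 2 (hne c (Set.Ioo_subset_Icc_self hc)))] at hc0
  linarith [hW c]

/-- The `n` gaps between the zeros of `P_{n+1}` each contain one of the `n` zeros of `P_n`, so the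
`k`-th gap contains the `k`-th zero. -/
theorem polyZero_succ_lt_polyZero (hp : PosDef s) (hs0 : s 0 = 1) (hk : k < n) :
    polyZero s (n + 1) k < polyZero s n k := by
  have hgap : ∀ i : Fin n, ∃ j : Fin n, polyZero s (n + 1) i < polyZero s n j ∧
      polyZero s n j < polyZero s (n + 1) (i + 1) := by
    intro i
    have hi : (i : ℕ) + 1 < n + 1 := Nat.succ_lt_succ i.2
    obtain ⟨z, hz, hz0⟩ := exists_eval_P_eq_zero_between hp hs0
      (polyZero_lt_polyZero hp hs0 (Nat.lt_succ_self (i : ℕ)) hi)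
      (eval_polyZero hp hs0 ((Nat.lt_succ_self _).trans hi)) (eval_polyZero hp hs0 hi)
    obtain ⟨j, hj, rfl⟩ := exists_polyZero_eq hp hs0 hz0
    exact ⟨⟨j, hj⟩, hz⟩
  choose f hf using hgap
  have hmono : StrictMono f := by
    intro i j hij
    have hlt : polyZero s n (f i) < polyZero s n (f j) := (hf i).2.trans_le
      ((polyZero_le_polyZero hp hs0 (Nat.succ_le_of_lt hij) (j.2.trans n.lt_succ_self)).trans
        (hf j).1.le)
    exact lt_of_not_ge fun hji => hlt.not_ge (polyZero_le_polyZero hp hs0 hji (f i).2)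
  have hid : f = id := (hmono.range_inj strictMono_id).1
    (by rw [(Finite.surjective_of_injective hmono.injective).range_eq, Set.range_id])
  have hlt := (hf ⟨k, hk⟩).1
  rwa [hid] at hlt

end Zeros

/-! ### Positivity of the zeros -/

section Signs

variable {s : ℕ → ℝ} {n : ℕ} {x y : ℝ}

/-- Otherwise `P_n = (X - x) q` with `x ≤ 0`, and `q * P_n = (X - x) q²` is nonnegative on the
half-line although `q` is orthogonal to `P_n`. -/
theorem PosDefS.pos_of_eval_P_eq_zero (hs : PosDefS s) (hx : (P s n).eval x = 0) : 0 < x := by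
  by_contra! hx0
  obtain ⟨q, hq⟩ := dvd_iff_isRoot.2 hx
  have hP := P_ne_zero hs.posDef n
  have hq0 : q ≠ 0 := fun h => hP (by rw [hq, h, mul_zero])
  have hdeg : q.degree < n := by
    rw [← degree_P hs.posDef n, hq, degree_mul, degree_X_sub_C, degree_eq_natDegree hq0]
    exact_mod_cast Nat.lt_one_add_iff.2 le_rfl
  refine (hs (q * P s n) (fun t ht => ?_) (mul_ne_zero hq0 hP)).ne'
    (momentFun_mul_P_eq_zero hs.posDef hdeg)
  rw [hq, mul_left_comm, eval_mul, eval_mul, eval_sub, eval_X, eval_C]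
  exact mul_nonneg (sub_nonneg.2 (hx0.trans ht)) (mul_self_nonneg _)

theorem PosDefS.polyZero_pos (hs : PosDefS s) (hs0 : s 0 = 1) {k : ℕ} (hk : k < n) :
    0 < polyZero s n k :=
  hs.pos_of_eval_P_eq_zero (eval_polyZero hs.posDef hs0 hk)

theorem PosDefS.eval_P_ne_zero (hs : PosDefS s) (n : ℕ) (hx : x ≤ 0) : (P s n).eval x ≠ 0 :=
  fun h => (hs.pos_of_eval_P_eq_zero h).not_ge hx

theorem PosDefS.neg_one_pow_mul_eval_P_pos (hs : PosDefS s) (hs0 : s 0 = 1) (n : ℕ) (hx : x ≤ 0) :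
    0 < (-1) ^ n * (P s n).eval x := by
  have hprod : 0 < ((P s n).roots.map fun r => r - x).prod := by
    refine Multiset.prod_pos fun a ha => ?_
    obtain ⟨r, hr, rfl⟩ := Multiset.mem_map.1 ha
    exact sub_pos.2 (hx.trans_lt (hs.pos_of_eval_P_eq_zero (isRoot_of_mem_roots hr)))
  have hneg := Multiset.prod_map_neg ((P s n).roots.map fun r => x - r)
  rw [Multiset.map_map, Multiset.card_map, card_roots_P hs.posDef hs0] at hneg
  simp only [Function.comp_def, neg_sub] at hneg
  rw [(splits_P hs.posDef hs0 n).eval_eq_prod_roots, mul_left_comm, ← hneg]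
  exact mul_pos (leadingCoeff_P_pos hs.posDef n) hprod

theorem PosDefS.eval_P_mul_eval_P_pos (hs : PosDefS s) (hs0 : s 0 = 1) (n : ℕ) (hx : x ≤ 0)
    (hy : y ≤ 0) : 0 < (P s n).eval x * (P s n).eval y := by
  have hpos := mul_pos (hs.neg_one_pow_mul_eval_P_pos hs0 n hx)
    (hs.neg_one_pow_mul_eval_P_pos hs0 n hy)
  rwa [mul_mul_mul_comm, ← mul_pow, neg_one_mul, neg_neg, one_pow, one_mul] at hpos

theorem PosDefS.eval_P_succ_mul_eval_P_neg (hs : PosDefS s) (hs0 : s 0 = 1) (n : ℕ) (hx : x ≤ 0) :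
    (P s (n + 1)).eval x * (P s n).eval x < 0 := by
  have hpos := mul_pos (hs.neg_one_pow_mul_eval_P_pos hs0 (n + 1) hx)
    (hs.neg_one_pow_mul_eval_P_pos hs0 n hx)
  rwa [mul_mul_mul_comm, pow_succ', mul_assoc (-1 : ℝ), ← mul_pow, neg_mul_neg, one_mul, one_pow,
    mul_one, neg_one_mul, neg_pos] at hpos

end Signs

/-! ### Gauss quadrature -/

section Quadrature

variable {s : ℕ → ℝ} {n : ℕ}

/-- The weight of the node `polyZero s n j` in the Gauss quadrature formula with `n` nodes. -/
def gaussWeight (s : ℕ → ℝ) (n j : ℕ) : ℝ :=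
  ((kernelPoly s n (polyZero s n j)).eval (polyZero s n j))⁻¹

theorem gaussWeight_pos (hs0 : s 0 = 1) (hn : 0 < n) (j : ℕ) : 0 < gaussWeight s n j :=
  inv_pos.2 (one_pos.trans_le (one_le_eval_kernelPoly_self hs0 hn _))

theorem eval_kernelPoly_polyZero_of_ne (hp : PosDef s) (hs0 : s 0 = 1) {i j : ℕ} (hi : i < n)
    (hj : j < n) (hij : i ≠ j) : (kernelPoly s n (polyZero s n i)).eval (polyZero s n j) = 0 := by
  obtain ⟨m, rfl⟩ := Nat.exists_eq_succ_of_ne_zero (Nat.ne_zero_of_lt hi)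
  have hCD := congrArg (Polynomial.eval (polyZero s (m + 1) j))
    (X_sub_C_mul_kernelPoly hp hs0 m (polyZero s (m + 1) i))
  simp only [eval_mul, eval_sub, eval_X, eval_C, eval_polyZero hp hs0 hi, eval_polyZero hp hs0 hj,
    zero_mul, mul_zero, sub_zero, mul_eq_zero] at hCD
  exact hCD.resolve_left (sub_ne_zero.2 ((injOn_polyZero hp hs0 (m + 1)).ne
    (Finset.mem_coe.2 (Finset.mem_range.2 hj)) (Finset.mem_coe.2 (Finset.mem_range.2 hi)) hij.symm))

/-- Lagrange interpolation at the zeros of `P_n`, the kernels being multiples of the basis. -/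
theorem eq_sum_gaussWeight_mul_kernelPoly (hp : PosDef s) (hs0 : s 0 = 1) {p : ℝ[X]}
    (hdeg : p.degree < n) : p = ∑ j ∈ Finset.range n,
      C (gaussWeight s n j * p.eval (polyZero s n j)) * kernelPoly s n (polyZero s n j) := by
  refine eq_of_degrees_lt_of_eval_index_eq (Finset.range n) (injOn_polyZero hp hs0 n)
    (by rwa [Finset.card_range]) ?_ fun i hi => ?_
  · rw [Finset.card_range]
    refine (degree_sum_le _ _).trans_lt ((Finset.sup_lt_iff (WithBot.bot_lt_coe n)).2 fun j _ => ?_)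
    rw [← smul_eq_C_mul]
    exact (degree_smul_le _ _).trans_lt (degree_kernelPoly_lt hp n _)
  · have hpos := one_pos.trans_le (one_le_eval_kernelPoly_self hs0
      (Nat.zero_lt_of_lt (Finset.mem_range.1 hi)) (polyZero s n i))
    rw [eval_finsetSum, Finset.sum_eq_single_of_mem i hi fun j hj hji => ?_]
    · rw [eval_mul, eval_C, gaussWeight, mul_right_comm, inv_mul_cancel₀ hpos.ne', one_mul]
    · rw [eval_mul, eval_kernelPoly_polyZero_of_ne hp hs0 (Finset.mem_range.1 hj)
        (Finset.mem_range.1 hi) hji, mul_zero]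

theorem sum_gaussWeight_mul_eval (hp : PosDef s) (hs0 : s 0 = 1) {p : ℝ[X]} (hdeg : p.degree < n) :
    ∑ j ∈ Finset.range n, gaussWeight s n j * p.eval (polyZero s n j) = momentFun s p := by
  conv_rhs => rw [eq_sum_gaussWeight_mul_kernelPoly hp hs0 hdeg, momentFun_sum]
  refine Finset.sum_congr rfl fun j hj => ?_
  rw [momentFun_C_mul, momentFun_kernelPoly hp (Nat.zero_lt_of_lt (Finset.mem_range.1 hj)), mul_one]

theorem sum_gaussWeight_mul_pow (hp : PosDef s) (hs0 : s 0 = 1) {r : ℕ} (hr : r < n) :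
    ∑ j ∈ Finset.range n, gaussWeight s n j * polyZero s n j ^ r = s r := by
  have hquad := sum_gaussWeight_mul_eval hp hs0 (n := n) (p := X ^ r)
    (by rw [degree_X_pow]; exact_mod_cast hr)
  simpa only [eval_pow, eval_X, momentFun_X_pow] using hquad

/-- With denominators cleared: the Stieltjes transform of the Gauss quadrature measure is
`-Q_n / P_n`. -/
theorem aeval_Q_add_aeval_P_mul_sum_gaussWeight (hp : PosDef s) (hs0 : s 0 = 1) {K : Type*}
    [Field K] [Algebra ℝ K] {z : K} (hz : ∀ j < n, algebraMap ℝ K (polyZero s n j) - z ≠ 0) :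
    aeval z (Q s n) + aeval z (P s n) * ∑ j ∈ Finset.range n,
      algebraMap ℝ K (gaussWeight s n j) * (algebraMap ℝ K (polyZero s n j) - z)⁻¹ = 0 := by
  let T : ℝ[X] →ₗ[ℝ] K := ∑ j ∈ Finset.range n,
    (algebraMap ℝ K (gaussWeight s n j) * (algebraMap ℝ K (polyZero s n j) - z)⁻¹) •
      (aeval (algebraMap ℝ K (polyZero s n j))).toLinearMap
  have hTapply : ∀ p, T p = ∑ j ∈ Finset.range n, algebraMap ℝ K (gaussWeight s n j) *
      (algebraMap ℝ K (polyZero s n j) - z)⁻¹ * algebraMap ℝ K (p.eval (polyZero s n j)) :=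
    fun p => by
      simp only [T, LinearMap.sum_apply, LinearMap.smul_apply, AlgHom.toLinearMap_apply,
        aeval_algebraMap_apply, coe_aeval_eq_eval, smul_eq_mul]
  have hT : ∀ m < n, T (X ^ (m + 1)) = z * T (X ^ m) + algebraMap ℝ K (s m) := by
    intro m hm
    rw [← sum_gaussWeight_mul_pow hp hs0 hm, hTapply, hTapply, map_sum, Finset.mul_sum,
      ← Finset.sum_add_distrib]
    refine Finset.sum_congr rfl fun j hj => ?_
    have hne := hz j (Finset.mem_range.1 hj)
    simp only [eval_pow, eval_X, map_mul, map_pow]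
    rw [pow_succ]
    field_simp
    ring
  rw [← secondKind_P hp hs0 n]
  have hzero := map_eq_aeval_secondKind hT (natDegree_P hp n).le
  simp only [hTapply, eval_one, map_one, mul_one] at hzero
  rw [← hzero]
  refine Finset.sum_eq_zero fun j hj => ?_
  rw [eval_polyZero hp hs0 (Finset.mem_range.1 hj), map_zero, mul_zero]

end Quadrature

/-! ### Convergence of `P_n(0) / Q_n(0)` -/

section Alpha

variable {s : ℕ → ℝ} {n : ℕ}

theorem PosDefS.eval_P_mul_eval_Q_neg (hs : PosDefS s) (hs0 : s 0 = 1) (hn : 0 < n) :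
    (P s n).eval 0 * (Q s n).eval 0 < 0 := by
  have hpos : ∀ j < n, 0 < polyZero s n j := fun j hj => hs.polyZero_pos hs0 hj
  have hgauss := aeval_Q_add_aeval_P_mul_sum_gaussWeight hs.posDef hs0 (z := (0 : ℝ))
    fun j hj => by simpa using (hpos j hj).ne'
  simp only [coe_aeval_eq_eval, Algebra.algebraMap_self, RingHom.id_apply, sub_zero] at hgauss
  have hsum : 0 < ∑ j ∈ Finset.range n, gaussWeight s n j * (polyZero s n j)⁻¹ :=
    Finset.sum_pos (fun j hj => mul_pos (gaussWeight_pos hs0 hn j)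
      (inv_pos.2 (hpos j (Finset.mem_range.1 hj)))) ⟨0, Finset.mem_range.2 hn⟩
  have hmul := mul_pos hsum (hs.eval_P_mul_eval_P_pos hs0 n le_rfl le_rfl)
  rw [eq_neg_of_add_eq_zero_left hgauss]
  linarith

theorem PosDefS.eval_Q_ne_zero (hs : PosDefS s) (hs0 : s 0 = 1) (hn : 0 < n) :
    (Q s n).eval 0 ≠ 0 :=
  right_ne_zero_of_mul (hs.eval_P_mul_eval_Q_neg hs0 hn).ne

theorem PosDefS.eval_P_div_eval_Q_neg (hs : PosDefS s) (hs0 : s 0 = 1) (hn : 0 < n) :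
    (P s n).eval 0 / (Q s n).eval 0 < 0 :=
  div_neg_iff.2 (mul_neg_iff.1 (hs.eval_P_mul_eval_Q_neg hs0 hn))

theorem PosDefS.eval_Q_succ_mul_eval_Q_neg (hs : PosDefS s) (hs0 : s 0 = 1) (hn : 0 < n) :
    (Q s (n + 1)).eval 0 * (Q s n).eval 0 < 0 := by
  have hPQ := mul_pos_of_neg_of_neg (hs.eval_P_mul_eval_Q_neg hs0 n.succ_pos)
    (hs.eval_P_mul_eval_Q_neg hs0 hn)
  rw [mul_mul_mul_comm] at hPQ
  exact neg_of_mul_pos_right hPQ (hs.eval_P_succ_mul_eval_P_neg hs0 n le_rfl).le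

theorem PosDefS.eval_P_div_eval_Q_le_succ (hs : PosDefS s) (hs0 : s 0 = 1) (hn : 0 < n) :
    (P s n).eval 0 / (Q s n).eval 0 ≤ (P s (n + 1)).eval 0 / (Q s (n + 1)).eval 0 := by
  have hcas := polyCasorati_Q_P_self hs.posDef hs0 (0 : ℝ) n
  simp only [polyCasorati, casorati, coe_aeval_eq_eval, Algebra.algebraMap_self,
    RingHom.id_apply] at hcas
  have hpos : 0 < (Q s (n + 1)).eval 0 * (P s n).eval 0 - (Q s n).eval 0 * (P s (n + 1)).eval 0 :=
    pos_of_mul_pos_right (hcas ▸ one_pos) (jacobiB_pos hs.posDef n).le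
  rw [← sub_nonneg,
    div_sub_div _ _ (hs.eval_Q_ne_zero hs0 n.succ_pos) (hs.eval_Q_ne_zero hs0 hn)]
  exact div_nonneg_of_nonpos (by linarith) (hs.eval_Q_succ_mul_eval_Q_neg hs0 hn).le

theorem PosDefS.tendsto_alpha (hs : PosDefS s) (hs0 : s 0 = 1) :
    Tendsto (fun n : ℕ => (P s n).eval 0 / (Q s n).eval 0) atTop (𝓝 (alpha s)) := by
  have hmono : Monotone fun n : ℕ => (P s (n + 1)).eval 0 / (Q s (n + 1)).eval 0 :=
    monotone_nat_of_le_succ fun n => hs.eval_P_div_eval_Q_le_succ hs0 n.succ_pos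
  have hlim := tendsto_atTop_ciSup hmono ⟨0, by
    rintro _ ⟨n, rfl⟩
    exact (hs.eval_P_div_eval_Q_neg hs0 n.succ_pos).le⟩
  exact tendsto_nhds_limUnder ⟨_, (tendsto_add_atTop_iff_nat
    (f := fun n : ℕ => (P s n).eval 0 / (Q s n).eval 0) 1).1 hlim⟩

theorem PosDefS.alpha_nonpos (hs : PosDefS s) (hs0 : s 0 = 1) : alpha s ≤ 0 :=
  le_of_tendsto (hs.tendsto_alpha hs0) (eventually_atTop.2
    ⟨1, fun _ hn => (hs.eval_P_div_eval_Q_neg hs0 hn).le⟩)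

end Alpha

/-! ### Negativity of `alpha` -/

section AlphaNeg

variable {s : ℕ → ℝ} {μ : Measure ℝ} {x : ℝ}

theorem aeval_complex_ofReal (p : ℝ[X]) (x : ℝ) : aeval (x : ℂ) p = ((p.eval x : ℝ) : ℂ) :=
  aeval_ofReal p x

theorem aeval_complex_zero (p : ℝ[X]) : aeval (0 : ℂ) p = ((p.eval 0 : ℝ) : ℂ) := by
  rw [← aeval_complex_ofReal, Complex.ofReal_zero]

theorem PosDefS.aeval_Q_zero_ne_zero (hs : PosDefS s) (hs0 : s 0 = 1) (n : ℕ) :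
    aeval (0 : ℂ) (Q s (n + 1)) ≠ 0 := by
  rw [aeval_complex_zero]
  exact_mod_cast hs.eval_Q_ne_zero hs0 n.succ_pos

theorem PosDefS.tendsto_aeval_P_div_aeval_Q (hs : PosDefS s) (hs0 : s 0 = 1) :
    Tendsto (fun n : ℕ => aeval (0 : ℂ) (P s (n + 1)) / aeval (0 : ℂ) (Q s (n + 1))) atTop
      (𝓝 (alpha s : ℂ)) := by
  simp only [aeval_complex_zero, ← Complex.ofReal_div]
  exact (Complex.continuous_ofReal.tendsto _).comp
    ((tendsto_add_atTop_iff_nat 1).2 (hs.tendsto_alpha hs0))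

theorem PosDefS.tendsto_aeval_P_div (hs : PosDefS s) (hs0 : s 0 = 1)
    (hP : LocallySquareSummable (P s)) (hQ : LocallySquareSummable (Q s)) {z : ℕ → ℂ} {a : ℂ}
    (hz : Tendsto z atTop (𝓝 a)) :
    Tendsto (fun n => -(aeval (z n) (P s (n + 1)) / aeval (0 : ℂ) (Q s (n + 1)))) atTop
      (𝓝 (nevB s a * alpha s - nevD s a)) := by
  refine (((tendsto_polyCasorati_nevB hs.posDef hs0 hP hQ hz).mul
    (hs.tendsto_aeval_P_div_aeval_Q hs0)).sub
      (tendsto_polyCasorati_nevD hs.posDef hs0 hP hz)).congr fun n => ?_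
  have hQ0 := hs.aeval_Q_zero_ne_zero hs0 n
  rw [aeval_succ_eq_polyCasorati hs.posDef hs0 (P s) (z n) 0 n]
  field_simp
  ring

theorem PosDefS.tendsto_aeval_Q_div (hs : PosDefS s) (hs0 : s 0 = 1)
    (hP : LocallySquareSummable (P s)) (hQ : LocallySquareSummable (Q s)) {z : ℕ → ℂ} {a : ℂ}
    (hz : Tendsto z atTop (𝓝 a)) :
    Tendsto (fun n => -(aeval (z n) (Q s (n + 1)) / aeval (0 : ℂ) (Q s (n + 1)))) atTop
      (𝓝 (nevA s a * alpha s - nevC s a)) := by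
  refine (((tendsto_polyCasorati_nevA hs.posDef hQ hz).mul
    (hs.tendsto_aeval_P_div_aeval_Q hs0)).sub
      (tendsto_polyCasorati_nevC hs.posDef hs0 hP hQ hz)).congr fun n => ?_
  have hQ0 := hs.aeval_Q_zero_ne_zero hs0 n
  rw [aeval_succ_eq_polyCasorati hs.posDef hs0 (Q s) (z n) 0 n]
  field_simp
  ring

theorem nevB_ofReal (s : ℕ → ℝ) (x : ℝ) :
    nevB s x = ((-1 + x * ∑' k, (P s k).eval x * (Q s k).eval 0 : ℝ) : ℂ) := by
  simp only [nevB, aeval_complex_zero, aeval_complex_ofReal]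
  push_cast
  rfl

theorem nevC_ofReal (s : ℕ → ℝ) (x : ℝ) :
    nevC s x = ((1 + x * ∑' k, (Q s k).eval x * (P s k).eval 0 : ℝ) : ℂ) := by
  simp only [nevC, aeval_complex_zero, aeval_complex_ofReal]
  push_cast
  rfl

theorem nevD_ofReal (s : ℕ → ℝ) (x : ℝ) :
    nevD s x = ((x * ∑' k, (P s k).eval x * (P s k).eval 0 : ℝ) : ℂ) := by
  simp only [nevD, aeval_complex_zero, aeval_complex_ofReal]
  push_cast
  rfl

theorem stieltjesTransform_ofReal (μ : Measure ℝ) (x : ℝ) :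
    stieltjesTransform μ x = ((∫ t, (t - x)⁻¹ ∂μ : ℝ) : ℂ) := by
  rw [stieltjesTransform, ← integral_complex_ofReal]
  simp only [Complex.ofReal_inv, Complex.ofReal_sub]

theorem LocallySquareSummable.summable_eval_mul {F G : ℕ → ℝ[X]} (hF : LocallySquareSummable F)
    (hG : LocallySquareSummable G) (x y : ℝ) :
    Summable fun n => (F n).eval x * (G n).eval y := by
  have hsum := hF.summable_mul hG x y
  simp only [aeval_complex_ofReal, ← Complex.ofReal_mul] at hsum
  exact Complex.summable_ofReal.1 hsum

theorem IsSolution.integrable_mul_inv (h : IsSolution s μ) (hμ : μ (Set.Iio 0) = 0) (hx : x < 0)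
    (p : ℝ[X]) : Integrable (fun t => p.eval t * (t - x)⁻¹) μ := by
  have hint := h.integrable_mul_resolvent (isResolventPoint_of_re_neg hμ (z := x) (by simpa)) p
  exact_mod_cast hint.re

theorem IsSolution.integral_eval_mul_inv (h : IsSolution s μ) (hμ : μ (Set.Iio 0) = 0) (hx : x < 0)
    (p : ℝ[X]) : ∫ t, p.eval t * (t - x)⁻¹ ∂μ =
      (secondKind s p).eval x + p.eval x * ∫ t, (t - x)⁻¹ ∂μ := by
  have hint := h.integral_eval_mul_resolvent
    (isResolventPoint_of_re_neg hμ (z := x) (by simpa)) p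
  rw [aeval_complex_ofReal, aeval_complex_ofReal, stieltjesTransform_ofReal] at hint
  simp only [← Complex.ofReal_sub, ← Complex.ofReal_inv, ← Complex.ofReal_mul,
    integral_complex_ofReal, ← Complex.ofReal_add] at hint
  exact_mod_cast hint

theorem IsSolution.eval_mul_secondKind_add_nonneg (h : IsSolution s μ) (hμ : μ (Set.Iio 0) = 0)
    (hx : x < 0) {p g : ℝ[X]} (hg : ∀ t, 0 ≤ t → 0 ≤ g.eval t)
    (h0 : momentFun s (g * (p /ₘ (X - C x)) * p) = 0) :
    0 ≤ p.eval x * ((secondKind s (p * g)).eval x + (p * g).eval x * ∫ t, (t - x)⁻¹ ∂μ) := by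
  have hdiv : ∀ t, p.eval t - p.eval x = (t - x) * (p /ₘ (X - C x)).eval t := fun t => by
    have hmod := congrArg (eval t) (modByMonic_add_div p (X - C x))
    simp only [modByMonic_X_sub_C_eq_C_eval, eval_add, eval_mul, eval_sub, eval_X, eval_C] at hmod
    linarith
  have hsq : p.eval x * ∫ t, (p * g).eval t * (t - x)⁻¹ ∂μ =
      ∫ t, (p * p * g).eval t * (t - x)⁻¹ ∂μ := by
    rw [← integral_const_mul, ← sub_zero (∫ t, (p * p * g).eval t * (t - x)⁻¹ ∂μ), ← h0,
      ← h.integral_eval, ← integral_sub (h.integrable_mul_inv hμ hx _) (h.integrable_eval _)]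
    refine integral_congr_ae ?_
    filter_upwards [ae_nonneg_of_measure_Iio hμ] with t ht
    have hne : t - x ≠ 0 := by linarith
    simp only [eval_mul]
    field_simp
    linear_combination (-(p.eval t * g.eval t)) * hdiv t
  rw [← h.integral_eval_mul_inv hμ hx, hsq]
  refine integral_nonneg_of_ae ?_
  filter_upwards [ae_nonneg_of_measure_Iio hμ] with t ht
  simp only [eval_mul]
  exact mul_nonneg (mul_nonneg (mul_self_nonneg _) (hg t ht)) (inv_nonneg.2 (by linarith))

theorem IsSolution.eval_P_mul_eval_Q_add_nonneg (hp : PosDef s) (hs0 : s 0 = 1)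
    (h : IsSolution s μ) (hμ : μ (Set.Iio 0) = 0) (hx : x < 0) (n : ℕ) :
    0 ≤ (P s n).eval x * ((Q s n).eval x + (P s n).eval x * ∫ t, (t - x)⁻¹ ∂μ) := by
  have horth : momentFun s (1 * (P s n /ₘ (X - C x)) * P s n) = 0 := by
    refine momentFun_mul_P_eq_zero hp ?_
    rw [one_mul, ← degree_P hp n]
    exact degree_divByMonic_lt _ (X - C x) (P_ne_zero hp n)
      (zero_lt_one.trans_eq (degree_X_sub_C x).symm)
  have hnonneg := h.eval_mul_secondKind_add_nonneg hμ hx (fun t _ => by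
    rw [eval_one]
    exact zero_le_one) horth
  rwa [mul_one, secondKind_P hp hs0] at hnonneg

theorem PosDefS.one_le_eval_kernelPoly_zero (hs : PosDefS s) (hs0 : s 0 = 1) {n : ℕ} (hn : 0 < n)
    (hx : x ≤ 0) : 1 ≤ (kernelPoly s n 0).eval x := by
  rw [eval_kernelPoly]
  have hle := Finset.single_le_sum (f := fun k => (P s k).eval 0 * (P s k).eval x)
    (fun k _ => (hs.eval_P_mul_eval_P_pos hs0 k le_rfl hx).le) (Finset.mem_range.2 hn)
  simpa only [P_zero hs0, eval_one, one_mul] using hle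

theorem secondKind_kernelPoly (hp : PosDef s) (hs0 : s 0 = 1) (n : ℕ) (y : ℝ) :
    (secondKind s (kernelPoly s n y)).eval x =
      ∑ k ∈ Finset.range n, (P s k).eval y * (Q s k).eval x := by
  simp only [kernelPoly, map_sum, secondKind_C_mul, secondKind_P hp hs0, eval_finsetSum, eval_mul,
    eval_C]

theorem degree_X_mul_divByMonic_le (p : ℝ[X]) (x : ℝ) :
    (X * (p /ₘ (X - C x))).degree ≤ p.degree := by
  by_cases h : p.degree < (X - C x).degree
  · rw [(divByMonic_eq_zero_iff (monic_X_sub_C x)).2 h, mul_zero, degree_zero]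
    exact bot_le
  · rw [← degree_add_divByMonic (monic_X_sub_C x) (not_lt.1 h), degree_mul, degree_X,
      degree_X_sub_C]

theorem PosDefS.one_add_mul_sum_eval_Q_add_nonneg (hs : PosDefS s) (hs0 : s 0 = 1)
    (h : IsSolution s μ) (hμ : μ (Set.Iio 0) = 0) (hx : x < 0) {n : ℕ} (hn : 0 < n) :
    0 ≤ 1 + x * ∑ k ∈ Finset.range n, (Q s k).eval x * (P s k).eval 0 +
      x * (∑ k ∈ Finset.range n, (P s k).eval x * (P s k).eval 0) * ∫ t, (t - x)⁻¹ ∂μ := by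
  have hp := hs.posDef
  have horth : momentFun s (X * (kernelPoly s n 0 /ₘ (X - C x)) * kernelPoly s n 0) = 0 := by
    rw [momentFun_mul_kernelPoly hp, eval_mul, eval_X, zero_mul]
    exact (degree_X_mul_divByMonic_le _ x).trans_lt (degree_kernelPoly_lt hp n 0)
  have hnonneg := nonneg_of_mul_nonneg_right
    (h.eval_mul_secondKind_add_nonneg hμ hx (fun t ht => by simpa) horth)
    (one_pos.trans_le (hs.one_le_eval_kernelPoly_zero hs0 hn hx.le))
  rw [mul_comm _ X, secondKind_X_mul, momentFun_kernelPoly hp hn] at hnonneg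
  simp only [eval_add, eval_mul, eval_X, eval_C, secondKind_kernelPoly hp hs0,
    eval_kernelPoly] at hnonneg
  simpa only [mul_comm, add_comm] using hnonneg

theorem PosDefS.mul_tsum_eval_P_le (hs : PosDefS s) (hs0 : s 0 = 1)
    (hP : LocallySquareSummable (P s)) (hx : x ≤ 0) :
    x * ∑' k, (P s k).eval x * (P s k).eval 0 ≤ x := by
  have hle := (hP.summable_eval_mul hP x 0).le_tsum 0
    fun k _ => (hs.eval_P_mul_eval_P_pos hs0 k hx le_rfl).le
  simp only [P_zero hs0, eval_one, mul_one] at hle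
  simpa only [mul_one] using mul_le_mul_of_nonpos_left hle hx

theorem PosDefS.nevC_add_nevD_mul_stieltjesTransform_nonneg (hs : PosDefS s) (hs0 : s 0 = 1)
    (hP : LocallySquareSummable (P s)) (hQ : LocallySquareSummable (Q s)) (h : IsSolution s μ)
    (hμ : μ (Set.Iio 0) = 0) (hx : x < 0) :
    0 ≤ (nevC s x + nevD s x * stieltjesTransform μ x).re := by
  rw [nevC_ofReal, nevD_ofReal, stieltjesTransform_ofReal, ← Complex.ofReal_mul,
    ← Complex.ofReal_add, Complex.ofReal_re]
  have hlim := (((hQ.summable_eval_mul hP x 0).hasSum.tendsto_sum_nat.const_mul x).const_add 1).add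
    (((hP.summable_eval_mul hP x 0).hasSum.tendsto_sum_nat.const_mul x).mul_const
      (∫ t, (t - x)⁻¹ ∂μ))
  exact ge_of_tendsto hlim ((eventually_gt_atTop 0).mono fun n hn =>
    hs.one_add_mul_sum_eval_Q_add_nonneg hs0 h hμ hx hn)

theorem PosDefS.nevanlinna_mul_add_nonneg (hs : PosDefS s) (hs0 : s 0 = 1)
    (hP : LocallySquareSummable (P s)) (hQ : LocallySquareSummable (Q s)) (h : IsSolution s μ)
    (hμ : μ (Set.Iio 0) = 0) (hx : x < 0) :
    0 ≤ ((nevB s x * alpha s - nevD s x) * ((nevA s x * alpha s - nevC s x) +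
      (nevB s x * alpha s - nevD s x) * stieltjesTransform μ x)).re := by
  have hPlim := hs.tendsto_aeval_P_div hs0 hP hQ (tendsto_const_nhds (x := (x : ℂ)))
  have hQlim := hs.tendsto_aeval_Q_div hs0 hP hQ (tendsto_const_nhds (x := (x : ℂ)))
  refine ge_of_tendsto' ((Complex.continuous_re.tendsto _).comp
    (hPlim.mul (hQlim.add (hPlim.mul_const (stieltjesTransform μ x))))) fun n => ?_
  have hnonneg := div_nonneg (h.eval_P_mul_eval_Q_add_nonneg hs.posDef hs0 hμ hx (n + 1))
    (sq_nonneg ((Q s (n + 1)).eval 0))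
  convert hnonneg using 1
  simp only [Function.comp_apply, stieltjesTransform_ofReal, aeval_complex_zero,
    aeval_complex_ofReal, ← Complex.ofReal_div, ← Complex.ofReal_neg, ← Complex.ofReal_mul,
    ← Complex.ofReal_add, Complex.ofReal_re]
  ring

/-- If `alpha s = 0`, the two bounds for the Stieltjes transform on the negative axis coincide. -/
theorem PosDefS.stieltjesTransform_eq_of_alpha_eq_zero (hs : PosDefS s) (hs0 : s 0 = 1)
    (hP : LocallySquareSummable (P s)) (hQ : LocallySquareSummable (Q s)) (h : IsSolution s μ)
    (hμ : μ (Set.Iio 0) = 0) (hα : alpha s = 0) (hx : x < 0) :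
    stieltjesTransform μ x = -(nevC s x / nevD s x) := by
  have hupper := hs.nevC_add_nevD_mul_stieltjesTransform_nonneg hs0 hP hQ h hμ hx
  have hlower := hs.nevanlinna_mul_add_nonneg hs0 hP hQ h hμ hx
  have hDneg := (hs.mul_tsum_eval_P_le hs0 hP hx.le).trans_lt hx
  rw [hα, Complex.ofReal_zero, mul_zero, mul_zero, zero_sub, zero_sub] at hlower
  rw [nevC_ofReal, nevD_ofReal, stieltjesTransform_ofReal] at hupper hlower ⊢
  generalize x * ∑' k, (P s k).eval x * (P s k).eval 0 = d at *
  generalize 1 + x * ∑' k, (Q s k).eval x * (P s k).eval 0 = c at *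
  generalize ∫ t, (t - x)⁻¹ ∂μ = m at *
  norm_cast at *
  rw [← neg_div, eq_div_iff hDneg.ne]
  have hle : c + d * m ≤ 0 := nonpos_of_mul_nonneg_right (a := d) (by linarith) hDneg
  linarith

theorem IndetS.alpha_neg (hs : IndetS s) (hs0 : s 0 = 1) : alpha s < 0 := by
  refine (hs.posDefS.alpha_nonpos hs0).lt_of_ne fun hα => ?_
  obtain ⟨hP, hQ⟩ := hs.locallySquareSummable hs0
  have hpos := hs.posDefS
  obtain ⟨μ₁, μ₂, h₁, h₂, hμ₁, hμ₂, hne⟩ := hs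
  have := h₁.isFiniteMeasure
  have := h₂.isFiniteMeasure
  refine hne (ext_of_stieltjesTransform_neg (h₁.real_univ.trans h₂.real_univ.symm) hμ₁ hμ₂
    fun x hx => ?_)
  rw [hpos.stieltjesTransform_eq_of_alpha_eq_zero hs0 hP hQ h₁ hμ₁ hα hx,
    hpos.stieltjesTransform_eq_of_alpha_eq_zero hs0 hP hQ h₂ hμ₂ hα hx]

end AlphaNeg

/-! ### The quotient `D / B` along the negative axis -/

section Quotient

theorem tendsto_tsum_mul_of_tendsto {ι : Type*} {l : Filter ι} {w : ℕ → ι → ℝ} {γ : ℕ → ℝ} {b : ℝ}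
    (hnonneg : ∀ᶠ i in l, ∀ k, 0 ≤ w k i) (hsum : ∀ᶠ i in l, HasSum (fun k => w k i) 1)
    (hzero : ∀ k, Tendsto (w k) l (𝓝 0)) (hγ : Tendsto γ atTop (𝓝 b)) :
    Tendsto (fun i => ∑' k, w k i * γ k) l (𝓝 b) := by
  rw [Metric.tendsto_nhds]
  intro ε hε
  obtain ⟨N, hN⟩ := Metric.tendsto_atTop.1 hγ (ε / 2) (half_pos hε)
  have hhead : Tendsto (fun i => ∑ k ∈ Finset.range N, w k i * ‖γ k - b‖) l (𝓝 0) := by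
    simpa only [zero_mul, Finset.sum_const_zero] using
      tendsto_finsetSum (Finset.range N) fun k _ => (hzero k).mul_const ‖γ k - b‖
  filter_upwards [hnonneg, hsum, hhead.eventually_lt_const (half_pos hε)] with i hi hsi hlt
  have hmajorant : HasSum
      (fun k => w k i * (ε / 2) + if k ∈ Finset.range N then w k i * ‖γ k - b‖ else 0)
      (1 * (ε / 2) + ∑ k ∈ Finset.range N, w k i * ‖γ k - b‖) := by
    refine (hsi.mul_right _).add ?_
    rw [← Finset.sum_congr rfl fun k hk => if_pos hk]
    exact hasSum_sum_of_ne_finset_zero fun k hk => if_neg hk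
  have hbound : ∀ k, ‖w k i * (γ k - b)‖ ≤
      w k i * (ε / 2) + if k ∈ Finset.range N then w k i * ‖γ k - b‖ else 0 := fun k => by
    rw [norm_mul, Real.norm_of_nonneg (hi k)]
    split_ifs with hk
    · exact le_add_of_nonneg_left (mul_nonneg (hi k) (half_pos hε).le)
    · rw [add_zero, ← dist_eq_norm]
      exact mul_le_mul_of_nonneg_left (hN k (by simpa using hk)).le (hi k)
  have hcentered : ∑' k, w k i * γ k - b = ∑' k, w k i * (γ k - b) := by
    have hadd := (Summable.of_norm_bounded hmajorant.summable hbound).hasSum.add (hsi.mul_right b)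
    simp only [← mul_add, sub_add_cancel, one_mul] at hadd
    rw [hadd.tsum_eq, add_sub_cancel_right]
  rw [dist_eq_norm, hcentered]
  linarith [tsum_of_norm_bounded hmajorant hbound]

variable {s : ℕ → ℝ}

theorem PosDefS.tendsto_eval_P_mul_div_tsum (hs : PosDefS s) (hs0 : s 0 = 1)
    (hP : LocallySquareSummable (P s)) (k : ℕ) :
    Tendsto (fun x => (P s k).eval x * (P s k).eval 0 / ∑' m, (P s m).eval x * (P s m).eval 0)
      atBot (𝓝 0) := by
  have hpos : ∀ {x : ℝ}, x < 0 → ∀ m, 0 < (P s m).eval x * (P s m).eval 0 := fun hx m =>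
    hs.eval_P_mul_eval_P_pos hs0 m hx.le le_rfl
  have hratio := (div_tendsto_atBot_zero_of_degree_lt (P s k) (P s (k + 1)) (by
    rw [degree_P hs.posDef, degree_P hs.posDef]
    exact_mod_cast k.lt_succ_self)).mul_const ((P s k).eval 0 / (P s (k + 1)).eval 0)
  simp only [zero_mul, div_mul_div_comm] at hratio
  refine squeeze_zero' ?_ ?_ hratio
  · filter_upwards [eventually_lt_atBot 0] with x hx
    exact div_nonneg (hpos hx k).le (tsum_nonneg fun m => (hpos hx m).le)
  · filter_upwards [eventually_lt_atBot 0] with x hx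
    exact div_le_div_of_nonneg_left (hpos hx k).le (hpos hx (k + 1))
      ((hP.summable_eval_mul hP x 0).le_tsum _ fun m _ => (hpos hx m).le)

/-- Up to `-1 / D`, the quotient `B / D` is the mean of the numbers `Q_k(0) / P_k(0)` with weights
proportional to `P_k(x) P_k(0)`. -/
theorem PosDefS.tendsto_tsum_div_tsum (hs : PosDefS s) (hs0 : s 0 = 1)
    (hP : LocallySquareSummable (P s)) (hα : alpha s ≠ 0) :
    Tendsto (fun x => (∑' k, (P s k).eval x * (Q s k).eval 0) /
      ∑' k, (P s k).eval x * (P s k).eval 0) atBot (𝓝 (alpha s)⁻¹) := by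
  have hpos : ∀ {x : ℝ}, x < 0 → ∀ k, 0 < (P s k).eval x * (P s k).eval 0 := fun hx k =>
    hs.eval_P_mul_eval_P_pos hs0 k hx.le le_rfl
  have hsumpos : ∀ {x : ℝ}, x < 0 → 0 < ∑' k, (P s k).eval x * (P s k).eval 0 := fun hx =>
    (hP.summable_eval_mul hP _ 0).tsum_pos (fun k => (hpos hx k).le) 0 (hpos hx 0)
  have hγ := (hs.tendsto_alpha hs0).inv₀ hα
  simp only [inv_div] at hγ
  refine (tendsto_tsum_mul_of_tendsto ?_ ?_ (hs.tendsto_eval_P_mul_div_tsum hs0 hP) hγ).congr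
    fun x => ?_
  · filter_upwards [eventually_lt_atBot 0] with x hx k
    exact div_nonneg (hpos hx k).le (hsumpos hx).le
  · filter_upwards [eventually_lt_atBot 0] with x hx
    rw [← div_self (hsumpos hx).ne']
    exact (hP.summable_eval_mul hP x 0).hasSum.div_const _
  · rw [← tsum_div_const]
    refine tsum_congr fun k => ?_
    rw [div_mul_eq_mul_div, mul_assoc, mul_div_cancel₀ _ (hs.eval_P_ne_zero k le_rfl)]

theorem IndetS.tendsto_nevD_div_nevB (hs : IndetS s) (hs0 : s 0 = 1) :
    Tendsto (fun x : ℝ => nevD s x / nevB s x) atBot (𝓝 (alpha s : ℂ)) := by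
  have hα := hs.alpha_neg hs0
  have hP := (hs.locallySquareSummable hs0).1
  have hD : Tendsto (fun x : ℝ => x * ∑' k, (P s k).eval x * (P s k).eval 0) atBot atBot :=
    tendsto_atBot_mono' _ ((eventually_le_atBot 0).mono
      fun x hx => hs.posDefS.mul_tsum_eval_P_le hs0 hP hx) tendsto_id
  have hBD : Tendsto (fun x : ℝ => (-1 + x * ∑' k, (P s k).eval x * (Q s k).eval 0) /
      (x * ∑' k, (P s k).eval x * (P s k).eval 0)) atBot (𝓝 (alpha s)⁻¹) := by
    have hlim := hD.inv_tendsto_atBot.neg.add (hs.posDefS.tendsto_tsum_div_tsum hs0 hP hα.ne)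
    rw [neg_zero, zero_add] at hlim
    refine hlim.congr' ?_
    filter_upwards [eventually_lt_atBot 0] with x hx
    rw [add_div, mul_div_mul_left _ _ hx.ne, neg_div, one_div, Pi.inv_apply]
  have hDB := hBD.inv₀ (inv_ne_zero hα.ne)
  simp only [inv_div, inv_inv] at hDB
  simp only [nevD_ofReal, nevB_ofReal, ← Complex.ofReal_div]
  exact (Complex.continuous_ofReal.tendsto _).comp hDB

end Quotient

/-! ### The limits of the zeros -/

section Xi

variable {s : ℕ → ℝ}

/-- The reproducing kernel `K(x, y) = ∑ P_k(x) P_k(y)`; it is meaningful only when the series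
converges, as it does in the indeterminate case. -/
def reproducingKernel (s : ℕ → ℝ) (x y : ℝ) : ℝ := ∑' k, (P s k).eval x * (P s k).eval y

theorem ofReal_reproducingKernel (s : ℕ → ℝ) (x y : ℝ) :
    (reproducingKernel s x y : ℂ) = ∑' k, aeval (x : ℂ) (P s k) * aeval (y : ℂ) (P s k) := by
  simp only [reproducingKernel, Complex.ofReal_tsum, Complex.ofReal_mul, aeval_complex_ofReal]

theorem tendsto_reproducingKernel (hP : LocallySquareSummable (P s)) {ι : Type*} {l : Filter ι}
    {x y : ι → ℝ} {a b : ℝ} (hx : Tendsto x l (𝓝 a)) (hy : Tendsto y l (𝓝 b)) :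
    Tendsto (fun i => reproducingKernel s (x i) (y i)) l (𝓝 (reproducingKernel s a b)) := by
  have hlim := hP.tendsto_tsum hP ((Complex.continuous_ofReal.tendsto a).comp hx)
    ((Complex.continuous_ofReal.tendsto b).comp hy)
  simp only [Function.comp_apply, ← ofReal_reproducingKernel] at hlim
  exact (Complex.continuous_re.tendsto _).comp hlim

theorem tendsto_eval_kernelPoly (hP : LocallySquareSummable (P s)) {x y : ℕ → ℝ} {a b : ℝ}
    (hx : Tendsto x atTop (𝓝 a)) (hy : Tendsto y atTop (𝓝 b)) :
    Tendsto (fun n => (kernelPoly s n (x n)).eval (y n)) atTop (𝓝 (reproducingKernel s a b)) := by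
  have hlim := hP.tendsto_sum_range hP ((Complex.continuous_ofReal.tendsto a).comp hx)
    ((Complex.continuous_ofReal.tendsto b).comp hy) tendsto_id
  rw [← ofReal_reproducingKernel] at hlim
  simp only [Function.comp_apply, id_eq, aeval_complex_ofReal, ← Complex.ofReal_mul,
    ← Complex.ofReal_sum, ← eval_kernelPoly] at hlim
  exact (Complex.continuous_re.tendsto _).comp hlim

theorem one_le_reproducingKernel_self (hs0 : s 0 = 1) (hP : LocallySquareSummable (P s)) (x : ℝ) :
    1 ≤ reproducingKernel s x x := by
  have hle := (hP.summable_eval_mul hP x x).le_tsum 0 fun k _ => mul_self_nonneg _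
  simpa only [reproducingKernel, P_zero hs0, eval_one, one_mul] using hle

theorem PosDefS.antitone_polyZero (hs : PosDefS s) (hs0 : s 0 = 1) (k : ℕ) :
    Antitone fun n => polyZero s (n + (k + 1)) k :=
  antitone_nat_of_succ_le fun n => by
    rw [Nat.add_right_comm]
    exact (polyZero_succ_lt_polyZero hs.posDef hs0 (by omega)).le

theorem PosDefS.tendsto_polyZero (hs : PosDefS s) (hs0 : s 0 = 1) (k : ℕ) :
    Tendsto (fun n : ℕ => polyZero s n k) atTop (𝓝 (xi s k)) := by
  have hlim := tendsto_atTop_ciInf (hs.antitone_polyZero hs0 k) ⟨0, by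
    rintro _ ⟨n, rfl⟩
    exact (hs.polyZero_pos hs0 (by omega)).le⟩
  exact tendsto_nhds_limUnder
    ⟨_, (tendsto_add_atTop_iff_nat (f := fun n : ℕ => polyZero s n k) (k + 1)).1 hlim⟩

theorem PosDefS.tendsto_ofReal_polyZero (hs : PosDefS s) (hs0 : s 0 = 1) (k : ℕ) :
    Tendsto (fun n : ℕ => (polyZero s n k : ℂ)) atTop (𝓝 (xi s k : ℂ)) :=
  (Complex.continuous_ofReal.tendsto _).comp (hs.tendsto_polyZero hs0 k)

theorem PosDefS.xi_le_polyZero (hs : PosDefS s) (hs0 : s 0 = 1) {n k : ℕ} (hk : k < n) :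
    xi s k ≤ polyZero s n k := by
  obtain ⟨m, rfl⟩ := Nat.exists_eq_add_of_le' hk
  exact (hs.antitone_polyZero hs0 k).le_of_tendsto
    ((tendsto_add_atTop_iff_nat (f := fun n : ℕ => polyZero s n k) (k + 1)).2
      (hs.tendsto_polyZero hs0 k)) m

theorem PosDefS.xi_nonneg (hs : PosDefS s) (hs0 : s 0 = 1) (k : ℕ) : 0 ≤ xi s k :=
  ge_of_tendsto (hs.tendsto_polyZero hs0 k)
    ((eventually_gt_atTop k).mono fun _ hn => (hs.polyZero_pos hs0 hn).le)

theorem PosDefS.monotone_xi (hs : PosDefS s) (hs0 : s 0 = 1) : Monotone (xi s) :=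
  fun i j hij => le_of_tendsto_of_tendsto (hs.tendsto_polyZero hs0 i) (hs.tendsto_polyZero hs0 j)
    ((eventually_gt_atTop j).mono fun _ hn => polyZero_le_polyZero hs.posDef hs0 hij hn)

theorem PosDefS.reproducingKernel_xi_of_ne (hs : PosDefS s) (hs0 : s 0 = 1)
    (hP : LocallySquareSummable (P s)) {i j : ℕ} (hij : i ≠ j) :
    reproducingKernel s (xi s i) (xi s j) = 0 := by
  refine tendsto_nhds_unique (tendsto_eval_kernelPoly hP (hs.tendsto_polyZero hs0 i)
    (hs.tendsto_polyZero hs0 j)) (tendsto_const_nhds.congr' ?_)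
  filter_upwards [eventually_gt_atTop i, eventually_gt_atTop j] with n hi hj
  exact (eval_kernelPoly_polyZero_of_ne hs.posDef hs0 hi hj hij).symm

theorem PosDefS.strictMono_xi (hs : PosDefS s) (hs0 : s 0 = 1)
    (hP : LocallySquareSummable (P s)) : StrictMono (xi s) := by
  refine (hs.monotone_xi hs0).strictMono_of_injective fun i j hij => ?_
  by_contra hne
  have hself := one_le_reproducingKernel_self hs0 hP (xi s i)
  have horth := hs.reproducingKernel_xi_of_ne hs0 hP hne
  rw [← hij] at horth
  linarith

/-- At a finite limit point `l` of `xi`, orthogonality of consecutive kernels would force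
`K(l, l) = 0`. -/
theorem PosDefS.tendsto_xi (hs : PosDefS s) (hs0 : s 0 = 1) (hP : LocallySquareSummable (P s)) :
    Tendsto (xi s) atTop atTop := by
  refine (tendsto_atTop_of_monotone (hs.monotone_xi hs0)).resolve_right ?_
  rintro ⟨l, hl⟩
  have hlim := tendsto_reproducingKernel hP hl ((tendsto_add_atTop_iff_nat 1).2 hl)
  simp only [hs.reproducingKernel_xi_of_ne hs0 hP (Nat.succ_ne_self _).symm] at hlim
  have hzero := tendsto_nhds_unique hlim tendsto_const_nhds
  linarith [one_le_reproducingKernel_self hs0 hP l]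

theorem PosDefS.nevB_mul_alpha_sub_nevD_xi (hs : PosDefS s) (hs0 : s 0 = 1)
    (hP : LocallySquareSummable (P s)) (hQ : LocallySquareSummable (Q s)) (k : ℕ) :
    nevB s (xi s k) * alpha s - nevD s (xi s k) = 0 := by
  refine tendsto_nhds_unique (hs.tendsto_aeval_P_div hs0 hP hQ
    ((tendsto_add_atTop_iff_nat 1).2 (hs.tendsto_ofReal_polyZero hs0 k)))
    (tendsto_const_nhds.congr' ?_)
  filter_upwards [eventually_ge_atTop k] with n hn
  rw [aeval_complex_ofReal, eval_polyZero hs.posDef hs0 (Nat.lt_succ_of_le hn), Complex.ofReal_zero,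
    zero_div, neg_zero]

theorem PosDefS.xi_pos (hs : PosDefS s) (hs0 : s 0 = 1) (hP : LocallySquareSummable (P s))
    (hQ : LocallySquareSummable (Q s)) (hα : alpha s ≠ 0) (k : ℕ) : 0 < xi s k := by
  refine (hs.xi_nonneg hs0 k).lt_of_ne' fun hzero => hα ?_
  have hxi := hs.nevB_mul_alpha_sub_nevD_xi hs0 hP hQ k
  simpa only [nevB, nevD, hzero, Complex.ofReal_zero, zero_mul, add_zero, sub_zero, neg_mul,
    one_mul, neg_eq_zero, Complex.ofReal_eq_zero] using hxi

theorem PosDefS.exists_le_norm_xi_sub (hs : PosDefS s) (hs0 : s 0 = 1)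
    (hP : LocallySquareSummable (P s)) {z : ℂ} (hz : ∀ k, (xi s k : ℂ) ≠ z) :
    ∃ δ > 0, ∀ k, δ ≤ ‖(xi s k : ℂ) - z‖ := by
  have hatTop : Tendsto (fun k => ‖(xi s k : ℂ) - z‖) cofinite atTop := by
    rw [Nat.cofinite_eq_atTop]
    refine tendsto_atTop_mono (fun k => ?_) (tendsto_atTop_add_const_right _ (-‖z‖)
      (hs.tendsto_xi hs0 hP))
    have hnorm := norm_sub_norm_le (xi s k : ℂ) z
    rwa [Complex.norm_of_nonneg (hs.xi_nonneg hs0 k)] at hnorm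
  obtain ⟨i, hi⟩ := hatTop.exists_forall_le
  exact ⟨_, norm_pos_iff.2 (sub_ne_zero.2 (hz i)), hi⟩

/-- Only finitely many zeros come near `z`, and those converge to points `xi s j ≠ z`. -/
theorem PosDefS.exists_eventually_le_norm_polyZero_sub (hs : PosDefS s) (hs0 : s 0 = 1)
    (hP : LocallySquareSummable (P s)) {z : ℂ} (hz : ∀ k, (xi s k : ℂ) ≠ z) :
    ∃ δ > 0, ∀ᶠ n in atTop, ∀ j < n, δ ≤ ‖(polyZero s n j : ℂ) - z‖ := by
  obtain ⟨δ, hδ, hxi⟩ := hs.exists_le_norm_xi_sub hs0 hP hz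
  obtain ⟨J, hJ⟩ := ((hs.tendsto_xi hs0 hP).eventually_ge_atTop (‖z‖ + δ / 2)).exists
  have hnear : ∀ᶠ n in atTop, ∀ j ∈ Finset.range J, δ / 2 < ‖(polyZero s n j : ℂ) - z‖ :=
    (eventually_all_finset _).2 fun j _ =>
      ((hs.tendsto_ofReal_polyZero hs0 j).sub_const z).norm.eventually_const_lt
        ((half_lt_self hδ).trans_le (hxi j))
  refine ⟨δ / 2, half_pos hδ, hnear.mono fun n hn j hj => ?_⟩
  rcases lt_or_ge j J with hjJ | hJj
  · exact (hn j (Finset.mem_range.2 hjJ)).le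
  · have hfar : ‖z‖ + δ / 2 ≤ polyZero s n j :=
      hJ.trans ((hs.monotone_xi hs0 hJj).trans (hs.xi_le_polyZero hs0 hj))
    have hnorm := norm_sub_norm_le (polyZero s n j : ℂ) z
    rw [Complex.norm_of_nonneg (hs.polyZero_pos hs0 hj).le] at hnorm
    linarith

theorem norm_aeval_Q_le (hp : PosDef s) (hs0 : s 0 = 1) {n : ℕ} (hn : 0 < n) {z : ℂ} {δ : ℝ}
    (hδ : 0 < δ) (hz : ∀ j < n, δ ≤ ‖(polyZero s n j : ℂ) - z‖) :
    ‖aeval z (Q s n)‖ ≤ δ⁻¹ * ‖aeval z (P s n)‖ := by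
  have hgauss := aeval_Q_add_aeval_P_mul_sum_gaussWeight hp hs0 (z := z) fun j hj =>
    norm_pos_iff.1 (hδ.trans_le (hz j hj))
  rw [eq_neg_of_add_eq_zero_left hgauss, norm_neg, norm_mul, mul_comm]
  refine mul_le_mul_of_nonneg_right ?_ (norm_nonneg _)
  have htotal := sum_gaussWeight_mul_pow hp hs0 hn
  simp only [pow_zero, mul_one, hs0] at htotal
  calc _ ≤ ∑ j ∈ Finset.range n, gaussWeight s n j * δ⁻¹ := by
        refine norm_sum_le_of_le _ fun j hj => ?_
        have hw := (gaussWeight_pos hs0 hn j).le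
        rw [norm_mul, norm_inv, Complex.coe_algebraMap, Complex.norm_of_nonneg hw]
        exact mul_le_mul_of_nonneg_left (inv_anti₀ hδ (hz j (Finset.mem_range.1 hj))) hw
    _ = δ⁻¹ := by rw [← Finset.sum_mul, htotal, one_mul]

/-- The bound `‖Q_n(z)‖ ≤ δ⁻¹ ‖P_n(z)‖` survives the limit, so a zero of `B α - D` off the range
of `xi` would also be a zero of `A α - C`, contradicting `A D - B C = 1`. -/
theorem PosDefS.nevB_mul_alpha_sub_nevD_ne_zero (hs : PosDefS s) (hs0 : s 0 = 1)
    (hP : LocallySquareSummable (P s)) (hQ : LocallySquareSummable (Q s)) {z : ℂ}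
    (hz : ∀ k, (xi s k : ℂ) ≠ z) : nevB s z * alpha s - nevD s z ≠ 0 := by
  intro hBD
  obtain ⟨δ, hδ, hgap⟩ := hs.exists_eventually_le_norm_polyZero_sub hs0 hP hz
  have hle : ‖nevA s z * alpha s - nevC s z‖ ≤ δ⁻¹ * ‖nevB s z * alpha s - nevD s z‖ := by
    refine le_of_tendsto_of_tendsto (hs.tendsto_aeval_Q_div hs0 hP hQ tendsto_const_nhds).norm
      ((hs.tendsto_aeval_P_div hs0 hP hQ tendsto_const_nhds).norm.const_mul δ⁻¹) ?_
    filter_upwards [(tendsto_add_atTop_nat 1).eventually hgap] with n hn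
    rw [norm_neg, norm_neg, norm_div, norm_div, ← mul_div_assoc]
    exact div_le_div_of_nonneg_right (norm_aeval_Q_le hs.posDef hs0 n.succ_pos hδ hn)
      (norm_nonneg _)
  rw [hBD, norm_zero, mul_zero, norm_le_zero_iff] at hle
  refine zero_ne_one (α := ℂ) ?_
  rw [← nevA_mul_nevD_sub_nevB_mul_nevC hs.posDef hs0 hP hQ z]
  linear_combination nevA s z * hBD - nevB s z * hle

theorem PosDefS.setOf_nevB_mul_alpha_sub_nevD_eq_zero (hs : PosDefS s) (hs0 : s 0 = 1)
    (hP : LocallySquareSummable (P s)) (hQ : LocallySquareSummable (Q s)) :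
    {z : ℂ | nevB s z * alpha s - nevD s z = 0} = Set.range fun k : ℕ => (xi s k : ℂ) := by
  ext z
  constructor
  · intro hz
    by_contra hrange
    exact hs.nevB_mul_alpha_sub_nevD_ne_zero hs0 hP hQ (fun k hk => hrange ⟨k, hk⟩) hz
  · rintro ⟨k, rfl⟩
    exact hs.nevB_mul_alpha_sub_nevD_xi hs0 hP hQ k

theorem PosDefS.isClosed_range_xi (hs : PosDefS s) (hs0 : s 0 = 1)
    (hP : LocallySquareSummable (P s)) : IsClosed (Set.range (xi s)) := by
  rw [← isOpen_compl_iff, Metric.isOpen_iff]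
  intro x hx
  obtain ⟨δ, hδ, hxi⟩ := hs.exists_le_norm_xi_sub hs0 hP (z := x)
    fun k hk => hx ⟨k, Complex.ofReal_injective hk⟩
  refine ⟨δ, hδ, ?_⟩
  rintro _ hball ⟨k, rfl⟩
  rw [Metric.mem_ball, Real.dist_eq, ← Real.norm_eq_abs, ← Complex.norm_real,
    Complex.ofReal_sub] at hball
  exact (hxi k).not_gt hball

end Xi

/-! ### The Friedrichs solution -/

section Friedrichs

section TermwiseLimit

variable {E : Type*} [NormedAddCommGroup E] {h : ℕ → ℕ → E} {g : ℕ → E}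

theorem summable_norm_of_tendsto_of_sum_range_le (hlim : ∀ j, Tendsto (h · j) atTop (𝓝 (g j)))
    {C : ℝ} (hle : ∀ᶠ n in atTop, ∑ j ∈ Finset.range n, ‖h n j‖ ≤ C) :
    Summable fun j => ‖g j‖ := by
  refine summable_of_sum_range_le (c := C) (fun _ => norm_nonneg _) fun N => le_of_tendsto
    (tendsto_finsetSum (Finset.range N) fun j _ => (hlim j).norm) ?_
  filter_upwards [hle, eventually_ge_atTop N] with n hn hN
  exact (Finset.sum_le_sum_of_subset_of_nonneg (Finset.range_mono hN)
    fun _ _ _ => norm_nonneg _).trans hn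

theorem tendsto_sum_range_of_uniform_tail (hlim : ∀ j, Tendsto (h · j) atTop (𝓝 (g j)))
    (hg : Summable g)
    (htail : ∀ ε > 0, ∃ J, ∀ᶠ n in atTop, ∑ j ∈ Finset.Ico J n, ‖h n j‖ < ε) :
    Tendsto (fun n => ∑ j ∈ Finset.range n, h n j) atTop (𝓝 (∑' j, g j)) := by
  have hunif : TendstoUniformlyOnFilter (fun J n => ∑ j ∈ Finset.range (min J n), h n j)
      (fun n => ∑ j ∈ Finset.range n, h n j) atTop atTop := by
    refine Metric.tendstoUniformlyOnFilter_iff.2 fun ε hε => ?_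
    obtain ⟨J₀, hJ₀⟩ := htail ε hε
    filter_upwards [(eventually_ge_atTop J₀).prod_mk hJ₀] with ⟨J, n⟩ ⟨hJ, hn⟩
    rw [dist_eq_norm, ← Finset.sum_range_add_sum_Ico _ (min_le_right J n), add_sub_cancel_left]
    refine ((norm_sum_le _ _).trans (Finset.sum_le_sum_of_subset_of_nonneg (fun j hj => ?_)
      fun _ _ _ => norm_nonneg _)).trans_lt hn
    simp only [Finset.mem_Ico] at hj ⊢
    omega
  refine hunif.tendsto_of_eventually_tendsto (.of_forall fun J => ?_) hg.hasSum.tendsto_sum_nat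
  refine (tendsto_finsetSum (Finset.range J) fun j _ => hlim j).congr' ?_
  filter_upwards [eventually_ge_atTop J] with n hn
  rw [min_eq_left hn]

end TermwiseLimit

variable {s : ℕ → ℝ}

/-- The mass that the Friedrichs solution gives to the point `xi s j`. -/
def mass (s : ℕ → ℝ) (j : ℕ) : ℝ := (reproducingKernel s (xi s j) (xi s j))⁻¹

theorem mass_pos (hs0 : s 0 = 1) (hP : LocallySquareSummable (P s)) (j : ℕ) : 0 < mass s j :=
  inv_pos.2 (one_pos.trans_le (one_le_reproducingKernel_self hs0 hP _))

theorem PosDefS.tendsto_gaussWeight (hs : PosDefS s) (hs0 : s 0 = 1)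
    (hP : LocallySquareSummable (P s)) (j : ℕ) :
    Tendsto (fun n => gaussWeight s n j) atTop (𝓝 (mass s j)) :=
  (tendsto_eval_kernelPoly hP (hs.tendsto_polyZero hs0 j) (hs.tendsto_polyZero hs0 j)).inv₀
    (one_pos.trans_le (one_le_reproducingKernel_self hs0 hP _)).ne'

section Quadrature

variable {E : Type*} [NormedAddCommGroup E] [NormedSpace ℝ E] {f : ℝ → E} {M : ℝ} {r n : ℕ}

theorem PosDefS.norm_gaussWeight_smul_le (hs : PosDefS s) (hs0 : s 0 = 1)
    (hf : ∀ x, 0 ≤ x → ‖f x‖ ≤ M * x ^ r) {j : ℕ} (hj : j < n) :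
    ‖gaussWeight s n j • f (polyZero s n j)‖ ≤ M * (gaussWeight s n j * polyZero s n j ^ r) := by
  have hw := (gaussWeight_pos hs0 (Nat.zero_lt_of_lt hj) j).le
  rw [norm_smul, Real.norm_of_nonneg hw, mul_left_comm]
  exact mul_le_mul_of_nonneg_left (hf _ (hs.polyZero_pos hs0 hj).le) hw

theorem PosDefS.sum_norm_gaussWeight_smul_le (hs : PosDefS s) (hs0 : s 0 = 1)
    (hf : ∀ x, 0 ≤ x → ‖f x‖ ≤ M * x ^ r) (hr : r < n) :
    ∑ j ∈ Finset.range n, ‖gaussWeight s n j • f (polyZero s n j)‖ ≤ M * s r := by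
  rw [← sum_gaussWeight_mul_pow hs.posDef hs0 hr, Finset.mul_sum]
  exact Finset.sum_le_sum fun j hj => hs.norm_gaussWeight_smul_le hs0 hf (Finset.mem_range.1 hj)

/-- Chebyshev's inequality: the nodes of index at least `J` are all at least `xi s J`. -/
theorem PosDefS.xi_mul_sum_Ico_norm_gaussWeight_smul_le (hs : PosDefS s) (hs0 : s 0 = 1)
    (hf : ∀ x, 0 ≤ x → ‖f x‖ ≤ M * x ^ r) (hr : r + 1 < n) (J : ℕ) :
    xi s J * ∑ j ∈ Finset.Ico J n, ‖gaussWeight s n j • f (polyZero s n j)‖ ≤ M * s (r + 1) := by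
  have hxf : ∀ x : ℝ, 0 ≤ x → ‖x • f x‖ ≤ M * x ^ (r + 1) := fun x hx => by
    rw [norm_smul, Real.norm_of_nonneg hx, pow_succ', mul_left_comm]
    exact mul_le_mul_of_nonneg_left (hf x hx) hx
  refine le_trans ?_ (hs.sum_norm_gaussWeight_smul_le hs0 hxf hr)
  rw [Finset.mul_sum, Finset.range_eq_Ico]
  refine (Finset.sum_le_sum fun j hj => ?_).trans (Finset.sum_le_sum_of_subset_of_nonneg
    (Finset.Ico_subset_Ico_left J.zero_le) fun _ _ _ => norm_nonneg _)
  obtain ⟨hJj, hjn⟩ := Finset.mem_Ico.1 hj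
  rw [smul_comm, norm_smul (polyZero s n j), Real.norm_of_nonneg (hs.polyZero_pos hs0 hjn).le]
  exact mul_le_mul_of_nonneg_right ((hs.monotone_xi hs0 hJj).trans (hs.xi_le_polyZero hs0 hjn))
    (norm_nonneg _)

theorem PosDefS.tendsto_gaussWeight_smul (hs : PosDefS s) (hs0 : s 0 = 1)
    (hP : LocallySquareSummable (P s)) {j : ℕ} (hcont : ContinuousAt f (xi s j)) :
    Tendsto (fun n => gaussWeight s n j • f (polyZero s n j)) atTop
      (𝓝 (mass s j • f (xi s j))) :=
  (hs.tendsto_gaussWeight hs0 hP j).smul (hcont.tendsto.comp (hs.tendsto_polyZero hs0 j))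

theorem PosDefS.summable_norm_mass_smul (hs : PosDefS s) (hs0 : s 0 = 1)
    (hP : LocallySquareSummable (P s)) (hcont : Continuous f)
    (hf : ∀ x, 0 ≤ x → ‖f x‖ ≤ M * x ^ r) : Summable fun j => ‖mass s j • f (xi s j)‖ :=
  summable_norm_of_tendsto_of_sum_range_le
    (fun _ => hs.tendsto_gaussWeight_smul hs0 hP hcont.continuousAt)
    ((eventually_gt_atTop r).mono fun _ hr => hs.sum_norm_gaussWeight_smul_le hs0 hf hr)

theorem PosDefS.tendsto_sum_gaussWeight_smul [CompleteSpace E] (hs : PosDefS s) (hs0 : s 0 = 1)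
    (hP : LocallySquareSummable (P s)) (hcont : Continuous f)
    (hf : ∀ x, 0 ≤ x → ‖f x‖ ≤ M * x ^ r) :
    Tendsto (fun n => ∑ j ∈ Finset.range n, gaussWeight s n j • f (polyZero s n j)) atTop
      (𝓝 (∑' j, mass s j • f (xi s j))) := by
  refine tendsto_sum_range_of_uniform_tail
    (fun _ => hs.tendsto_gaussWeight_smul hs0 hP hcont.continuousAt)
    (hs.summable_norm_mass_smul hs0 hP hcont hf).of_norm fun ε hε => ?_
  obtain ⟨J, hJ, hpos⟩ := (((hs.tendsto_xi hs0 hP).eventually_gt_atTop (M * s (r + 1) / ε)).and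
    ((hs.tendsto_xi hs0 hP).eventually_gt_atTop 0)).exists
  refine ⟨J, (eventually_gt_atTop (r + 1)).mono fun n hn => lt_of_mul_lt_mul_left ?_ hpos.le⟩
  exact (hs.xi_mul_sum_Ico_norm_gaussWeight_smul_le hs0 hf hn J).trans_lt ((div_lt_iff₀ hε).1 hJ)

end Quadrature

/-- The limit of the Gauss quadrature measures, which turns out to be the Friedrichs solution. -/
def friedrichs (s : ℕ → ℝ) : Measure ℝ :=
  Measure.sum fun j => ENNReal.ofReal (mass s j) • Measure.dirac (xi s j)

section Integral

variable {E : Type*} [NormedAddCommGroup E] [NormedSpace ℝ E] {f : ℝ → E}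

theorem integrable_friedrichs (hs0 : s 0 = 1) (hP : LocallySquareSummable (P s))
    (hf : StronglyMeasurable f) (hsum : Summable fun j => ‖mass s j • f (xi s j)‖) :
    Integrable f (friedrichs s) := by
  refine ⟨hf.aestronglyMeasurable, ?_⟩
  rw [HasFiniteIntegral, friedrichs, lintegral_sum_measure]
  refine lt_of_eq_of_lt (tsum_congr fun j => ?_) hsum.tsum_ofReal_lt_top
  rw [lintegral_smul_measure, lintegral_dirac' _ hf.enorm, smul_eq_mul, norm_smul,
    Real.norm_of_nonneg (mass_pos hs0 hP j).le, ENNReal.ofReal_mul (mass_pos hs0 hP j).le,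
    ofReal_norm]

theorem integral_friedrichs [CompleteSpace E] (hs0 : s 0 = 1) (hP : LocallySquareSummable (P s))
    (hf : StronglyMeasurable f) (hsum : Summable fun j => ‖mass s j • f (xi s j)‖) :
    ∫ x, f x ∂(friedrichs s) = ∑' j, mass s j • f (xi s j) := by
  rw [friedrichs, ← (hasSum_integral_measure (integrable_friedrichs hs0 hP hf hsum)).tsum_eq]
  refine tsum_congr fun j => ?_
  rw [integral_smul_measure, integral_dirac, ENNReal.toReal_ofReal (mass_pos hs0 hP j).le]

theorem PosDefS.tendsto_sum_gaussWeight_smul_integral_friedrichs [CompleteSpace E]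
    (hs : PosDefS s) (hs0 : s 0 = 1) (hP : LocallySquareSummable (P s)) (hcont : Continuous f)
    {M : ℝ} {r : ℕ} (hf : ∀ x, 0 ≤ x → ‖f x‖ ≤ M * x ^ r) :
    Tendsto (fun n => ∑ j ∈ Finset.range n, gaussWeight s n j • f (polyZero s n j)) atTop
      (𝓝 (∫ x, f x ∂(friedrichs s))) := by
  rw [integral_friedrichs hs0 hP hcont.stronglyMeasurable
    (hs.summable_norm_mass_smul hs0 hP hcont hf)]
  exact hs.tendsto_sum_gaussWeight_smul hs0 hP hcont hf

end Integral

theorem PosDefS.isSolution_friedrichs (hs : PosDefS s) (hs0 : s 0 = 1)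
    (hP : LocallySquareSummable (P s)) : IsSolution s (friedrichs s) := by
  intro r
  have hcont : Continuous fun x : ℝ => x ^ r := continuous_pow r
  have hf : ∀ x : ℝ, 0 ≤ x → ‖x ^ r‖ ≤ 1 * x ^ r := fun x hx => by
    rw [one_mul, Real.norm_of_nonneg (pow_nonneg hx r)]
  refine ⟨integrable_friedrichs hs0 hP hcont.stronglyMeasurable
    (hs.summable_norm_mass_smul hs0 hP hcont hf), ?_⟩
  refine tendsto_nhds_unique
    (hs.tendsto_sum_gaussWeight_smul_integral_friedrichs hs0 hP hcont hf)
    (tendsto_const_nhds.congr' ?_)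
  filter_upwards [eventually_gt_atTop r] with n hn
  exact (sum_gaussWeight_mul_pow hs.posDef hs0 hn).symm

theorem PosDefS.stieltjesTransform_friedrichs (hs : PosDefS s) (hs0 : s 0 = 1)
    (hP : LocallySquareSummable (P s)) (hQ : LocallySquareSummable (Q s)) {z : ℂ}
    (hz : z.im ≠ 0) : stieltjesTransform (friedrichs s) z =
      -((nevA s z * alpha s - nevC s z) / (nevB s z * alpha s - nevD s z)) := by
  have hne := ofReal_sub_ne_zero hz
  have hcont : Continuous fun x : ℝ => ((x : ℂ) - z)⁻¹ :=
    (Complex.continuous_ofReal.sub continuous_const).inv₀ hne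
  have hf : ∀ x : ℝ, 0 ≤ x → ‖((x : ℂ) - z)⁻¹‖ ≤ |z.im|⁻¹ * x ^ 0 := fun x _ => by
    rw [pow_zero, mul_one, norm_inv]
    refine inv_anti₀ (abs_pos.2 hz) ?_
    simpa using Complex.abs_im_le_norm ((x : ℂ) - z)
  have hBD := hs.nevB_mul_alpha_sub_nevD_ne_zero hs0 hP hQ (z := z)
    fun k hk => hne _ (sub_eq_zero.2 hk)
  have hlim := ((hs.tendsto_aeval_Q_div hs0 hP hQ (tendsto_const_nhds (x := z))).div
    (hs.tendsto_aeval_P_div hs0 hP hQ tendsto_const_nhds) hBD).neg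
  refine tendsto_nhds_unique ((tendsto_add_atTop_iff_nat 1).2
    (hs.tendsto_sum_gaussWeight_smul_integral_friedrichs hs0 hP hcont hf))
    (hlim.congr fun n => ?_)
  have hQ0 := hs.aeval_Q_zero_ne_zero hs0 n
  have hPz : aeval z (P s (n + 1)) ≠ 0 := fun h => hz (im_eq_zero_of_aeval_P hs.posDef hs0 h)
  have hgauss := aeval_Q_add_aeval_P_mul_sum_gaussWeight hs.posDef hs0 (n := n + 1)
    fun j _ => hne (polyZero s (n + 1) j)
  simp only [Complex.coe_algebraMap] at hgauss
  simp only [Complex.real_smul]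
  rw [Pi.div_apply, eq_neg_of_add_eq_zero_left hgauss]
  field_simp

theorem IsFriedrichs.unique {ν₁ ν₂ : Measure ℝ} (h₁ : IsFriedrichs s ν₁)
    (h₂ : IsFriedrichs s ν₂) : ν₁ = ν₂ := by
  have := h₁.1.isFiniteMeasure
  have := h₂.1.isFiniteMeasure
  exact ext_of_stieltjesTransform (h₁.1.real_univ.trans h₂.1.real_univ.symm)
    fun z hz => (h₁.2 z hz).trans (h₂.2 z hz).symm

theorem PosDefS.isFriedrichs_iff (hs : PosDefS s) (hs0 : s 0 = 1)
    (hP : LocallySquareSummable (P s)) (hQ : LocallySquareSummable (Q s)) {ν : Measure ℝ} :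
    IsFriedrichs s ν ↔ ν = friedrichs s := by
  have hfried : IsFriedrichs s (friedrichs s) :=
    ⟨hs.isSolution_friedrichs hs0 hP, fun _ hz => hs.stieltjesTransform_friedrichs hs0 hP hQ hz⟩
  exact ⟨fun hν => hν.unique hfried, fun hν => hν ▸ hfried⟩

theorem PosDefS.support_friedrichs (hs : PosDefS s) (hs0 : s 0 = 1)
    (hP : LocallySquareSummable (P s)) : (friedrichs s).support = Set.range (xi s) := by
  have hclosed := hs.isClosed_range_xi hs0 hP
  refine Set.Subset.antisymm (Measure.support_subset_of_isClosed hclosed ?_) ?_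
  · rw [mem_ae_iff, friedrichs, Measure.sum_apply _ hclosed.measurableSet.compl]
    refine ENNReal.tsum_eq_zero.2 fun j => ?_
    rw [Measure.smul_apply, Measure.dirac_apply' _ hclosed.measurableSet.compl]
    simp
  · rintro _ ⟨j, rfl⟩
    rw [Measure.mem_support_iff_forall]
    intro U hU
    calc 0 < ENNReal.ofReal (mass s j) := ENNReal.ofReal_pos.2 (mass_pos hs0 hP j)
      _ = (ENNReal.ofReal (mass s j) • Measure.dirac (xi s j)) U := by
        rw [Measure.smul_apply, Measure.dirac_apply_of_mem (mem_of_mem_nhds hU), smul_eq_mul,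
          mul_one]
      _ ≤ friedrichs s U := (ENNReal.le_tsum j).trans (Measure.le_sum_apply _ U)

end Friedrichs

end StieltjesMoment

end

theorem mainTheorem2 (s : ℕ → ℝ) (hs0 : s 0 = 1) (hs : StieltjesMoment.IndetS s) :
    -- the series and limits that define the objects converge
    (∀ z : ℂ, (Summable fun k : ℕ => ‖aeval z (StieltjesMoment.P s k)‖ ^ 2) ∧
      Summable fun k : ℕ => ‖aeval z (StieltjesMoment.Q s k)‖ ^ 2) ∧
    Tendsto (fun n : ℕ => (StieltjesMoment.P s n).eval 0 / (StieltjesMoment.Q s n).eval 0)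
      atTop (𝓝 (StieltjesMoment.alpha s)) ∧
    Tendsto (fun x : ℝ => StieltjesMoment.nevD s x / StieltjesMoment.nevB s x)
      atBot (𝓝 (StieltjesMoment.alpha s : ℂ)) ∧
    (∀ k : ℕ, Tendsto (fun n : ℕ => StieltjesMoment.polyZero s n k) atTop
      (𝓝 (StieltjesMoment.xi s k))) ∧
    -- `0 < ξ_1 < ξ_2 < …`, tending to infinity
    0 < StieltjesMoment.xi s 0 ∧ StrictMono (StieltjesMoment.xi s) ∧
    Tendsto (StieltjesMoment.xi s) atTop atTop ∧
    -- the `ξ_k` are exactly the zeros of the entire function `B(z) α(s) - D(z)`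
    Differentiable ℂ (fun z : ℂ =>
      StieltjesMoment.nevB s z * StieltjesMoment.alpha s - StieltjesMoment.nevD s z) ∧
    {z : ℂ | StieltjesMoment.nevB s z * StieltjesMoment.alpha s - StieltjesMoment.nevD s z = 0} =
      Set.range (fun k : ℕ => (StieltjesMoment.xi s k : ℂ)) ∧
    -- the Friedrichs solution exists, is unique, and has support `{ξ_k}`
    (∃! ν : Measure ℝ, StieltjesMoment.IsFriedrichs s ν) ∧
    ∀ ν : Measure ℝ, StieltjesMoment.IsFriedrichs s ν →
      ν.support = Set.range (StieltjesMoment.xi s) := by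
  obtain ⟨hP, hQ⟩ := hs.locallySquareSummable hs0
  have hpos := hs.posDefS
  have hfriedrichs {ν : Measure ℝ} := hpos.isFriedrichs_iff hs0 hP hQ (ν := ν)
  refine ⟨fun z => ⟨hP.summable_norm_sq z, hQ.summable_norm_sq z⟩, hpos.tendsto_alpha hs0,
    hs.tendsto_nevD_div_nevB hs0, hpos.tendsto_polyZero hs0,
    hpos.xi_pos hs0 hP hQ (hs.alpha_neg hs0).ne 0, hpos.strictMono_xi hs0 hP,
    hpos.tendsto_xi hs0 hP,
    ((StieltjesMoment.differentiable_nevB hP hQ).mul_const _).sub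
      (StieltjesMoment.differentiable_nevD hP),
    hpos.setOf_nevB_mul_alpha_sub_nevD_eq_zero hs0 hP hQ,
    ⟨StieltjesMoment.friedrichs s, hfriedrichs.2 rfl, fun _ hν => hfriedrichs.1 hν⟩,
    fun ν hν => ?_⟩
  rw [hfriedrichs.1 hν]
  exact hpos.support_friedrichs hs0 hP
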